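/- Let $\mathbb F$ be a field of characteristic $0$, let $k_1,k_2\ge 1$ be integers and $k=k_1+k_2$. Let $A=M_{k\times k}(\mathbb F)=A_0\oplus A_1$, where $A_0$ consists of the block-diagonal and $A_1$ of the block-off-diagonal matrices with respect to $k=k_1+k_2$, and let $E_{p,q}$ be the matrix units. For $i,j\in\mathbb Z_2=\{0,1\}$, $u\in A_{i+j}$ and $m,n\in\mathbb N=\{0,1,2,\dots\}$ let $u_{[i,j]}(m,n)=u_{[i,j]}\otimes t_1^mt_2^n$, where $u_{[i,j]}$ is the $2\times2$ matrix over $A$ with the entry $u$ at position $(i,j)$ and $0$ elsewhere; let $R(A)$ be the span of all $u_{[i,j]}(m,n)$. Put $\partial u_{[i,j]}(m,n)=(m+1)u_{[i,j]}(m+1,n)+(n+1)u_{[i,j]}(m,n+1)$, and let $Y^+(x,z)y=\sum_{n\ge0}(x_ny)z^{-n-1}$ be the bilinear operation on $R(A)$ with $$\begin{aligned}Y^+(u_{[i_1,i_2]}(m_1,m_2),z)\,&v_{[j_1,j_2]}(n_1,n_2)\\ ={}&\delta_{i_2,j_1}(n_1\delta_{i_2,0}+1)\tbinom{-n_1-1-\delta_{i_2,0}}{m_2}\sum_{p=0}^{m_1+m_2+n_1+\delta_{i_2,0}}\tbinom{p}{m_1}(uv)_{[i_1,j_2]}(p,n_2)\,z^{p-m_1-m_2-n_1-1-\delta_{i_2,0}}\\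 &-(-1)^{(i_1+i_2)(j_1+j_2)}\delta_{i_1,j_2}\bigl(\delta_{i_1,1}-(n_2+1)\delta_{i_1,0}\bigr)\tbinom{-n_2-1-\delta_{i_1,0}}{m_1}\sum_{q=0}^{m_1+m_2+n_2+\delta_{i_1,0}}\tbinom{q}{m_2}(vu)_{[j_1,i_2]}(n_1,q)\,z^{q-m_1-m_2-n_2-1-\delta_{i_1,0}}.\end{aligned}$$ The element $u_{[i,j]}(m,n)$ has weight $m+n+\delta_{i,0}+\delta_{j,0}+\frac12(\delta_{i,1}+\delta_{j,1})$. A conformal superalgebra is a $\mathbb Z_2$-graded $\mathbb F[\partial]$-module $R=R_0\oplus R_1$ with bilinear products $(u,v)\mapsto u_nv$ ($n\in\mathbb N$) such that $R_i{}_{\,n}R_j\subset R_{i+j}$, $u_nv=0$ for $n\gg0$ (depending on $u,v$), $(\partial u)_nv=-n\,u_{n-1}v$, and, for $u\in R_i$, $v\in R_j$, $$u_nv=(-1)^{ij}\sum_{l\ge0}\frac{(-1)^{n+l+1}}{l!}\,\partial^l(v_{n+l}u),\qquad u_mv_n-(-1)^{ij}v_nu_m=\sum_{l=0}^m\binom ml(u_lv)_{m+n-l}.$$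 An ideal is a subspace stable under $\partial$ and under all $u_n$ ($u\in R$, $n\in\mathbb N$); $R$ is simple if its only ideals are $\{0\}$ and $R$; $R$ is generated by a subset $S$ if it is spanned by the elements $u^1_{m_1}\cdots u^p_{m_p}v$ with $p,m_j\in\mathbb N$ and $u^j,v\in S$. Let $R_{[k_1,k_2],1}\subset R(A)$ be the span of all $(E_{p,q})_{[0,0]}(m,n)$, $(E_{k_1+r,k_1+s})_{[1,1]}(m,n)$, $(E_{p,k_1+r})_{[0,1]}(m,n)$ and $(E_{k_1+r,p})_{[1,0]}(m,n)$ with $1\le p,q\le k_1$, $1\le r,s\le k_2$, $m,n\in\mathbb N$. Let $R^*_{[k_1,k_2]}=(R^*_{[k_1,k_2]})_0+(R^*_{[k_1,k_2]})_1$, where $(R^*_{[k_1,k_2]})_0$ is the span of all $$(E_{p,q})_{[0,0]}(m,n)+(E_{q,p})_{[0,0]}(n,m),\qquad (E_{k_1+r,k_1+s})_{[1,1]}(m,n)-(E_{k_1+s,k_1+r})_{[1,1]}(n,m),$$ and $(R^*_{[k_1,k_2]})_1$ is the span of all $(E_{p,k_1+r})_{[0,1]}(m,n)+(E_{k_1+r,p})_{[1,0]}(n,m)$,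 for $p,q,r,s,m,n$ in the same ranges. **Theorem 4.2.** The space $R^*_{[k_1,k_2]}$ is contained in $R_{[k_1,k_2],1}\subset R(A)$ and is stable under $\partial$ and all the products $x_ny$. With these operations and the grading by $(R^*_{[k_1,k_2]})_0$ and $(R^*_{[k_1,k_2]})_1$ it is a conformal superalgebra, and it is simple. Its subspace of weight $3/2$ is $$(R^*_{[k_1,k_2]})^{(3/2)}=\operatorname{span}\{(E_{p,k_1+r})_{[0,1]}(0,0)+(E_{k_1+r,p})_{[1,0]}(0,0)\mid 1\le p\le k_1,\ 1\le r\le k_2\}.$$ If $k>2$, then $R^*_{[k_1,k_2]}$ is generated by $(R^*_{[k_1,k_2]})^{(3/2)}$. If $k=2$ (so $k_1=k_2=1$), it is generated by the two elements $(E_{1,2})_{[0,1]}(0,0)+(E_{2,1})_{[1,0]}(0,0)$ and $(E_{2,2})_{[1,1]}(0,1)-(E_{2,2})_{[1,1]}(1,0)$. -/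

import Mathlib

open scoped Nat

noncomputable section

/-! ## Conformal superalgebras -/

/-- A conformal superalgebra over a field `F` with underlying space `R`, in component form:
`Y⁺(u, z) v = ∑ₙ (mul n u v) z^(-n-1)`, where `mul n u v` is the `n`-th product `u_n v`.
The fields `mul_D_zero`, `mul_D_succ` are the components of `Y⁺(∂u, z) = d/dz Y⁺(u, z)`, the field
`skew` those of `Y⁺(u, z) v = (-1)^(ij) Res_x e^(x∂) Y⁺(v, -x) u / (z - x)`, and `jacobi` those of
`[Y⁺(u, z₁), Y⁺(v, z₂)] = Res_x Y⁺(Y⁺(u, z₁ - x) v, x) / (z₂ - x)` (supercommutator). -/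
structure ConformalSuperalgebra (F R : Type*) [Field F] [AddCommGroup R] [Module F R] where
  /-- the even part `parity 0` and the odd part `parity 1` -/
  parity : ZMod 2 → Submodule F R
  parity_isCompl : IsCompl (parity 0) (parity 1)
  /-- the operator `∂` -/
  D : R →ₗ[F] R
  D_mem : ∀ (i : ZMod 2) (u : R), u ∈ parity i → D u ∈ parity i
  /-- the `n`-th product -/
  mul : ℕ → R →ₗ[F] R →ₗ[F] R
  mul_mem : ∀ (i j : ZMod 2) (u v : R), u ∈ parity i → v ∈ parity j →
    ∀ n : ℕ, mul n u v ∈ parity (i + j)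
  truncation : ∀ u v : R, ∃ N : ℕ, ∀ n : ℕ, N ≤ n → mul n u v = 0
  mul_D_zero : ∀ u v : R, mul 0 (D u) v = 0
  mul_D_succ : ∀ (n : ℕ) (u v : R), mul (n + 1) (D u) v = (-((n : F) + 1)) • mul n u v
  /-- `N` is any bound beyond which the products of `v` and `u` vanish, so that the sum is the sum
  over all `l : ℕ`. -/
  skew : ∀ (i j : ZMod 2) (u v : R), u ∈ parity i → v ∈ parity j →
    ∀ n N : ℕ, (∀ m : ℕ, N ≤ m → mul m v u = 0) →
      mul n u v = ((-1 : F) ^ (i.val * j.val)) • ∑ l ∈ Finset.range N,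
        ((-1 : F) ^ (n + l + 1) * ((l ! : ℕ) : F)⁻¹) • (D ^ l) (mul (n + l) v u)
  jacobi : ∀ (i j : ZMod 2) (u v : R), u ∈ parity i → v ∈ parity j →
    ∀ (m n : ℕ) (w : R),
      mul m u (mul n v w) - ((-1 : F) ^ (i.val * j.val)) • mul n v (mul m u w) =
        ∑ l ∈ Finset.range (m + 1), ((m.choose l : ℕ) : F) • mul (m + n - l) (mul l u v) w

namespace ConformalSuperalgebra

variable {F R : Type*} [Field F] [AddCommGroup R] [Module F R]

/-- Ideals: subspaces stable under `∂` and under all `u_n`. They need not be graded. -/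
def IsIdeal (C : ConformalSuperalgebra F R) (I : Submodule F R) : Prop :=
  (∀ x ∈ I, C.D x ∈ I) ∧ ∀ (n : ℕ) (u : R), ∀ x ∈ I, C.mul n u x ∈ I

/-- The only ideals are `0` and the whole algebra. -/
def IsSimple (C : ConformalSuperalgebra F R) : Prop :=
  ∀ I : Submodule F R, C.IsIdeal I → I = ⊥ ∨ I = ⊤

/-- `IsNested C S x`: the element `x` has the form `u¹_{m₁} ⋯ uᵖ_{mₚ} v` with `p ≥ 0` and
`uʲ, v ∈ S`. -/
inductive IsNested (C : ConformalSuperalgebra F R) (S : Set R) : R → Prop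
  | base (v : R) (hv : v ∈ S) : IsNested C S v
  | step (u : R) (hu : u ∈ S) (m : ℕ) (w : R) (hw : IsNested C S w) : IsNested C S (C.mul m u w)

/-- The algebra is generated by `S`: it is the linear span of the elements
`u¹_{m₁} ⋯ uᵖ_{mₚ} v` with `uʲ, v ∈ S`. -/
def IsGeneratedBy (C : ConformalSuperalgebra F R) (S : Set R) : Prop :=
  Submodule.span F {x : R | C.IsNested S x} = ⊤

end ConformalSuperalgebra

/-! ## The algebra attached to a `ℤ/2`-graded associative algebra -/

namespace DoubleAffine

/-- The space `M₂(A) ⊗ F[t₁, t₂]`: the coefficient at `((i, j), (m, n))` is the coefficient of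
`t₁^m t₂^n` in the matrix entry at position `(i, j)`. -/
abbrev Ambient (A : Type*) [Ring A] : Type _ := (ZMod 2 × ZMod 2) × (ℕ × ℕ) →₀ A

variable {F A : Type*} [Field F] [Ring A] [Algebra F A]

/-- The element `u_{[i,j]}(m, n) = u_{[i,j]} ⊗ t₁^m t₂^n`. -/
def elt (i j : ZMod 2) (m n : ℕ) (u : A) : Ambient A := Finsupp.single ((i, j), (m, n)) u

/-- The Kronecker symbol `δ_{i,0}`. -/
def del0 (i : ZMod 2) : ℕ := if i = 0 then 1 else 0

/-- The Kronecker symbol `δ_{i,1}`. -/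
def del1 (i : ZMod 2) : ℕ := if i = 1 then 1 else 0

/-- The scalar of the `u v`-term of the `n`-th product of `u_{[i₁,i₂]}(m₁,m₂)` and
`v_{[j₁,j₂]}(n₁,n₂)`; this term sits at the exponents `(m₁ + m₂ + n₁ + δ_{i₂,0} - n, n₂)`. -/
def coeffLeft (n : ℕ) (a b : (ZMod 2 × ZMod 2) × (ℕ × ℕ)) : ℤ :=
  let ((_, i₂), (m₁, m₂)) := a
  let ((j₁, _), (n₁, _)) := b
  let M : ℕ := m₁ + m₂ + n₁ + del0 i₂
  if i₂ = j₁ ∧ n ≤ M then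
    ((n₁ : ℤ) * del0 i₂ + 1) * Ring.choose (-(n₁ : ℤ) - 1 - del0 i₂) m₂ *
      (((M - n).choose m₁ : ℕ) : ℤ)
  else 0

/-- The scalar of the `v u`-term of the `n`-th product of `u_{[i₁,i₂]}(m₁,m₂)` and
`v_{[j₁,j₂]}(n₁,n₂)`; this term sits at the exponents `(n₁, m₁ + m₂ + n₂ + δ_{i₁,0} - n)`. -/
def coeffRight (n : ℕ) (a b : (ZMod 2 × ZMod 2) × (ℕ × ℕ)) : ℤ :=
  let ((i₁, i₂), (m₁, m₂)) := a
  let ((j₁, j₂), (_, n₂)) := b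
  let M : ℕ := m₁ + m₂ + n₂ + del0 i₁
  if i₁ = j₂ ∧ n ≤ M then
    -(-1) ^ ((i₁ + i₂).val * (j₁ + j₂).val) *
      ((del1 i₁ : ℤ) - ((n₂ : ℤ) + 1) * del0 i₁) *
      Ring.choose (-(n₂ : ℤ) - 1 - del0 i₁) m₁ * (((M - n).choose m₂ : ℕ) : ℤ)
  else 0

/-- The `n`-th product restricted to the components with indices `a` and `b`. -/
def basicMul (F : Type*) {A : Type*} [Field F] [Ring A] [Algebra F A] (n : ℕ)
    (a b : (ZMod 2 × ZMod 2) × (ℕ × ℕ)) : A →ₗ[F] A →ₗ[F] Ambient A :=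
  ((coeffLeft n a b : ℤ) : F) • (LinearMap.mul F A).compr₂
      (Finsupp.lsingle ((a.1.1, b.1.2), (a.2.1 + a.2.2 + b.2.1 + del0 a.1.2 - n, b.2.2))) +
  ((coeffRight n a b : ℤ) : F) • (LinearMap.mul F A).flip.compr₂
      (Finsupp.lsingle ((b.1.1, a.1.2), (b.2.1, a.2.1 + a.2.2 + b.2.2 + del0 a.1.1 - n)))

/-- The `n`-th product, i.e. the coefficient of `z^(-n-1)` in `Y⁺(x, z) y`, extended bilinearly;
see `mul_elt` for its values on the spanning elements. -/
def mul (F : Type*) {A : Type*} [Field F] [Ring A] [Algebra F A] (n : ℕ) :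
    Ambient A →ₗ[F] Ambient A →ₗ[F] Ambient A :=
  Finsupp.lsum F fun a => (Finsupp.lsum F fun b => (basicMul F n a b).flip).flip

theorem mul_elt (n : ℕ) (i₁ i₂ j₁ j₂ : ZMod 2) (m₁ m₂ n₁ n₂ : ℕ) (u v : A) :
    mul F n (elt i₁ i₂ m₁ m₂ u) (elt j₁ j₂ n₁ n₂ v) =
      ((coeffLeft n ((i₁, i₂), (m₁, m₂)) ((j₁, j₂), (n₁, n₂)) : ℤ) : F) •
        elt i₁ j₂ (m₁ + m₂ + n₁ + del0 i₂ - n) n₂ (u * v) +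
      ((coeffRight n ((i₁, i₂), (m₁, m₂)) ((j₁, j₂), (n₁, n₂)) : ℤ) : F) •
        elt j₁ i₂ n₁ (m₁ + m₂ + n₂ + del0 i₁ - n) (v * u) := by
  simp [mul, elt, basicMul]

/-- The operator `∂`; see `D_elt`. -/
def D (F : Type*) {A : Type*} [Field F] [Ring A] [Algebra F A] : Ambient A →ₗ[F] Ambient A :=
  Finsupp.lsum F fun a =>
    ((a.2.1 : F) + 1) • Finsupp.lsingle (a.1, (a.2.1 + 1, a.2.2)) +
    ((a.2.2 : F) + 1) • Finsupp.lsingle (a.1, (a.2.1, a.2.2 + 1))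

theorem D_elt (i j : ZMod 2) (m n : ℕ) (u : A) :
    D F (elt i j m n u) =
      ((m : F) + 1) • elt i j (m + 1) n u + ((n : F) + 1) • elt i j m (n + 1) u := by
  simp [D, elt]

/-- The space `R(𝒜) = N(𝒜) ⊗ F[t₁, t₂]` of a `ℤ/2`-graded algebra `A = 𝒜 0 ⊕ 𝒜 1`, where `N(𝒜)`
consists of the `2 × 2` matrices over `A` whose `(i, j)` entry lies in `𝒜 (i + j)`. -/
def fullSpace (𝒜 : ZMod 2 → Submodule F A) : Submodule F (Ambient A) :=
  Submodule.span F {x | ∃ (i j : ZMod 2) (m n : ℕ), ∃ u ∈ 𝒜 (i + j), x = elt i j m n u}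

/-- The subspace of weight `w` of `R(𝒜)`. -/
def weightSpace (𝒜 : ZMod 2 → Submodule F A) (w : ℚ) : Submodule F (Ambient A) :=
  Submodule.span F {x | ∃ (i j : ZMod 2) (m n : ℕ), ∃ u ∈ 𝒜 (i + j),
    (m : ℚ) + n + del0 i + del0 j + ((del1 i : ℚ) + del1 j) / 2 = w ∧ x = elt i j m n u}

/-! ## The matrix case -/

/-- Square matrices of size `k₁ + k₂`, written in blocks. -/
abbrev Mat (F : Type*) (k₁ k₂ : ℕ) : Type _ := Matrix (Fin k₁ ⊕ Fin k₂) (Fin k₁ ⊕ Fin k₂) F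

/-- The index of the block. -/
def blk {k₁ k₂ : ℕ} : Fin k₁ ⊕ Fin k₂ → ZMod 2 := Sum.elim (fun _ => 0) (fun _ => 1)

/-- The grading of the matrix algebra: block-diagonal matrices are even, block-off-diagonal
matrices are odd. -/
def matGrading (F : Type*) [Field F] (k₁ k₂ : ℕ) (i : ZMod 2) : Submodule F (Mat F k₁ k₂) where
  carrier := {M | ∀ p q, blk p + blk q ≠ i → M p q = 0}
  add_mem' := by
    intro M N hM hN p q h
    simp [hM p q h, hN p q h]
  zero_mem' := by
    intro p q _
    rfl
  smul_mem' := by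
    intro c M hM p q h
    simp [hM p q h]

/-- The element `(E_{p,q})_{[i,j]}(m, n)`. -/
def E (F : Type*) [Field F] {k₁ k₂ : ℕ} (i j : ZMod 2) (p q : Fin k₁ ⊕ Fin k₂) (m n : ℕ) :
    Ambient (Mat F k₁ k₂) :=
  elt i j m n (Matrix.single p q (1 : F))

open Sum in
/-- The even and the odd part of `R_{[k₁,k₂],ℓ+1}`. -/
def blockPart (F : Type*) [Field F] (k₁ k₂ l : ℕ) (i : ZMod 2) :
    Submodule F (Ambient (Mat F k₁ k₂)) :=
  if i = 0 then
    Submodule.span F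
      ({x | ∃ (p q : Fin k₁) (m n : ℕ), x = E F 0 0 (inl p) (inl q) m (n + l)} ∪
       {x | ∃ (p q : Fin k₂) (m n : ℕ), x = E F 1 1 (inr p) (inr q) m (n + l)})
  else
    Submodule.span F
      ({x | ∃ (p : Fin k₁) (q : Fin k₂) (m n : ℕ), x = E F 0 1 (inl p) (inr q) m (n + l)} ∪
       {x | ∃ (p : Fin k₁) (q : Fin k₂) (m n : ℕ), x = E F 1 0 (inr q) (inl p) m (n + l)})

/-- The space `R_{[k₁,k₂],ℓ+1}`. -/
def blockAlg (F : Type*) [Field F] (k₁ k₂ l : ℕ) : Submodule F (Ambient (Mat F k₁ k₂)) :=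
  blockPart F k₁ k₂ l 0 ⊔ blockPart F k₁ k₂ l 1

open Sum in
/-- The even and the odd part of the transpose-twisted space `R*_{[k₁,k₂]}`. -/
def starPart (F : Type*) [Field F] (k₁ k₂ : ℕ) (i : ZMod 2) :
    Submodule F (Ambient (Mat F k₁ k₂)) :=
  if i = 0 then
    Submodule.span F
      ({x | ∃ (p q : Fin k₁) (m n : ℕ),
          x = E F 0 0 (inl p) (inl q) m n + E F 0 0 (inl q) (inl p) n m} ∪
       {x | ∃ (p q : Fin k₂) (m n : ℕ),
          x = E F 1 1 (inr p) (inr q) m n - E F 1 1 (inr q) (inr p) n m})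
  else
    Submodule.span F
      {x | ∃ (p : Fin k₁) (q : Fin k₂) (m n : ℕ),
          x = E F 0 1 (inl p) (inr q) m n + E F 1 0 (inr q) (inl p) n m}

/-- The transpose-twisted space `R*_{[k₁,k₂]}`. -/
def starAlg (F : Type*) [Field F] (k₁ k₂ : ℕ) : Submodule F (Ambient (Mat F k₁ k₂)) :=
  starPart F k₁ k₂ 0 ⊔ starPart F k₁ k₂ 1

end DoubleAffine

end

/-! Generating functions in divided powers turn the binomial sums into matrix algebra. An element
becomes a polynomial in `x`, `y` with values in 2 × 2 matrices over `A` (`ev`), and the products are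
collected into the λ-bracket ∑ lⁿ/n! uₙv (`bracket`). For homogeneous u, v the definition collapses
(`ev_bracket`) to u(x, -l-x) C(x+l) v(x+l, y) ∓ v(x, y+l) C(-l-y) u(-l-y, y), with C(s) = diag(s,
1), while ∂ is multiplication by x + y. Skew-symmetry is then the substitution l ↦ -l-(x+y), which
exchanges the two terms, and the Jacobi identity is the one for supercommutators in an associative
algebra. Component identities are read off again because a polynomial vanishing on an infinite field
is zero.

The signed transposition `twist` commutes with ∂ and preserves all products (`twist_mul`), because
it interchanges the two terms above. Since 2 is invertible, R* is the fixed space of `twist` inside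
the block algebra (`mem_starAlg`), hence stable.

Simplicity and generation rest on the elements `quad a`, that is α_p² and ψ_r∂ψ_r. Their first
products are diagonal on the matrix units (`mul_one_quad_unit`), and an index contributes a nonzero
eigenvalue exactly when it occurs. Projecting to joint eigenspaces, a nonzero ideal contains an
off-diagonal symmetric unit or is moved to one by an odd generator (`exists_odd_symUnit_mem`).
Lowering the exponents and squaring gives some `quad a`, and skew-symmetry then gives every element
with the index `a`, whence all of R* (`eq_bot_or_eq_starAlg`).

For generation, the Jacobi identity makes the span of nested products closed under all products
(`mul_mem_span_isNested`). The odd generators together with all `quad a` produce everything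
(`symUnit_mem_of_generators`). The square of an odd generator is only a difference of two `quad`s; a
third index isolates one of them (`exists_quad_mem`), and for k = 2 one has to be added to the
generating set. -/

open scoped Nat

noncomputable section

namespace DoubleAffine

/-! ### Divided powers and the generating functions of the structure constants. -/

section Scalars

variable {F : Type*} [Field F]

/-- The divided power `x ^ n / n!`. -/
def dpow (x : F) (n : ℕ) : F := ((n ! : ℕ) : F)⁻¹ * x ^ n

theorem dpow_neg (x : F) (n : ℕ) : dpow (-x) n = (-1) ^ n * dpow x n := by
  rw [dpow, dpow, neg_pow]; ring

theorem choose_neg_cast (N m : ℕ) :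
    ((Ring.choose (-(N : ℤ) - 1) m : ℤ) : F) = (-1) ^ m * ((N + m).choose m : F) := by
  have : -(N : ℤ) - 1 = -((N : ℤ) + 1) := by ring
  rw [this, Ring.choose_neg]
  have h2 : ((N : ℤ) + 1 + m - 1) = ((N + m : ℕ) : ℤ) := by push_cast; ring
  rw [h2, Ring.choose_natCast]
  rcases Nat.even_or_odd m with hm | hm
  · simp [hm.neg_one_pow, Int.negOnePow_even _ ((Int.even_coe_nat m).2 hm)]
  · simp [hm.neg_one_pow, Int.negOnePow_odd _ ((Int.odd_coe_nat m).2 hm)]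

variable [CharZero F]

theorem dpow_succ (x : F) (n : ℕ) : ((n : F) + 1) * dpow x (n + 1) = x * dpow x n := by
  have h : ((n : F) + 1) ≠ 0 := by exact_mod_cast n.succ_ne_zero
  have h2 : ((n ! : ℕ) : F) ≠ 0 := by exact_mod_cast n.factorial_ne_zero
  rw [dpow, dpow, Nat.factorial_succ]
  push_cast
  field_simp
  ring

theorem dpow_mul (x : F) (a b : ℕ) :
    dpow x a * dpow x b = ((a + b).choose a : F) * dpow x (a + b) := by
  have h1 : ((a ! : ℕ) : F) ≠ 0 := by exact_mod_cast a.factorial_ne_zero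
  have h2 : ((b ! : ℕ) : F) ≠ 0 := by exact_mod_cast b.factorial_ne_zero
  have h3 : (((a + b)! : ℕ) : F) ≠ 0 := by exact_mod_cast (a + b).factorial_ne_zero
  have h : ((a + b).choose a : F) * (a ! : ℕ) * (b ! : ℕ) = ((a + b)! : ℕ) := by
    have := Nat.choose_mul_factorial_mul_factorial (Nat.le_add_right a b)
    rw [Nat.add_sub_cancel_left] at this
    exact_mod_cast this
  rw [dpow, dpow, dpow, ← h]
  have h4 : ((a + b).choose a : F) ≠ 0 := by
    exact_mod_cast (Nat.choose_pos (Nat.le_add_right a b)).ne'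
  field_simp
  ring

theorem dpow_add (x y : F) (n : ℕ) :
    dpow (x + y) n = ∑ p ∈ Finset.HasAntidiagonal.antidiagonal n, dpow x p.1 * dpow y p.2 := by
  have h : ((n ! : ℕ) : F) ≠ 0 := by exact_mod_cast n.factorial_ne_zero
  rw [dpow, (Commute.all x y).add_pow', Finset.mul_sum]
  refine Finset.sum_congr rfl fun p hp => ?_
  obtain rfl := Finset.HasAntidiagonal.mem_antidiagonal.1 hp
  have h1 : ((p.1 ! : ℕ) : F) ≠ 0 := by exact_mod_cast p.1.factorial_ne_zero
  have h2 : ((p.2 ! : ℕ) : F) ≠ 0 := by exact_mod_cast p.2.factorial_ne_zero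
  have h3 : ((p.1 + p.2).choose p.1 : F) * (p.1 ! : ℕ) * (p.2 ! : ℕ) = ((p.1 + p.2)! : ℕ) := by
    have := Nat.choose_mul_factorial_mul_factorial (Nat.le_add_right p.1 p.2)
    rw [Nat.add_sub_cancel_left] at this
    exact_mod_cast this
  have h4 : ((p.1 + p.2).choose p.1 : F) ≠ 0 := by
    exact_mod_cast (Nat.choose_pos (Nat.le_add_right _ _)).ne'
  rw [dpow, dpow, ← h3, nsmul_eq_mul]
  field_simp

/-- The contraction factor of a pair of generators of index `i`. -/
def contr (i : ZMod 2) (s : F) : F := if i = 0 then s else 1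

/-- The binomial coefficient splits `dpow x (m + Q - n)` into `dpow x m * dpow x (Q - n)`, and the
binomial theorem sums the rest. Terms with `Q < n` carry a vanishing coefficient. -/
theorem sum_dpow_choose (l x : F) (m Q B : ℕ) (hB : m + Q < B) :
    ∑ n ∈ Finset.range B, dpow l n *
      ((if n ≤ m + Q then ((m + Q - n).choose m : F) else 0) * dpow x (m + Q - n)) =
    dpow x m * dpow (x + l) Q := by
  have h1 : Finset.range (Q + 1) ⊆ Finset.range B := by
    intro n; simp only [Finset.mem_range]; omega
  rw [← Finset.sum_subset h1, add_comm x l, dpow_add, Finset.mul_sum,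
    Finset.Nat.sum_antidiagonal_eq_sum_range_succ_mk]
  · refine Finset.sum_congr rfl fun n hn => ?_
    have hn' : n ≤ Q := by simpa [Nat.lt_succ_iff] using hn
    have h : m + Q - n = m + (Q - n) := by omega
    rw [if_pos (by omega), h, ← dpow_mul]
    ring
  · intro n _ hn
    have hn' : Q < n := by simpa using hn
    by_cases h : n ≤ m + Q
    · rw [Nat.choose_eq_zero_of_lt (by omega)]; simp
    · simp [h]

/-- The generating function of the scalars `coeffLeft`. -/
theorem sum_coeffLeft (l x : F) (i₁ i₂ j₁ j₂ : ZMod 2) (m₁ m₂ n₁ n₂ B : ℕ)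
    (hB : m₁ + m₂ + n₁ + del0 i₂ < B) :
    ∑ n ∈ Finset.range B, dpow l n *
      ((coeffLeft n ((i₁, i₂), (m₁, m₂)) ((j₁, j₂), (n₁, n₂)) : ℤ) *
        dpow x (m₁ + m₂ + n₁ + del0 i₂ - n)) =
    if i₂ = j₁ then dpow x m₁ * dpow (-l - x) m₂ * contr i₂ (x + l) * dpow (x + l) n₁ else 0 := by
  by_cases hij : i₂ = j₁
  swap
  · simp [coeffLeft, hij]
  have h := sum_dpow_choose l x m₁ (m₂ + n₁ + del0 i₂) B (by omega)
  have e : m₁ + (m₂ + n₁ + del0 i₂) = m₁ + m₂ + n₁ + del0 i₂ := by ring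
  rw [e] at h
  -- This is where the contraction factor arises: for index 0 the scalar `n₁ + 1` turns the divided
  -- power of order `n₁ + 1` into `x + l` times that of order `n₁`.
  have key : ((n₁ : F) * del0 i₂ + 1) * dpow (x + l) (n₁ + del0 i₂) =
      contr i₂ (x + l) * dpow (x + l) n₁ := by
    by_cases h0 : i₂ = 0
    · simp [del0, contr, h0, dpow_succ]
    · simp [del0, contr, h0]
  have e2 : -(n₁ : ℤ) - 1 - del0 i₂ = -((n₁ + del0 i₂ : ℕ) : ℤ) - 1 := by push_cast; ring
  have e3 : m₂ + n₁ + del0 i₂ = n₁ + del0 i₂ + m₂ := by ring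
  have h2 := dpow_mul (x + l) m₂ (n₁ + del0 i₂)
  rw [show m₂ + (n₁ + del0 i₂) = n₁ + del0 i₂ + m₂ by ring] at h2
  rw [if_pos hij, show -l - x = -(x + l) by ring, dpow_neg]
  calc _ = ((n₁ : F) * del0 i₂ + 1) * ((-1) ^ m₂ * ((n₁ + del0 i₂ + m₂).choose m₂ : F)) *
        ∑ n ∈ Finset.range B, dpow l n *
          ((if n ≤ m₁ + m₂ + n₁ + del0 i₂ then
            ((m₁ + m₂ + n₁ + del0 i₂ - n).choose m₁ : F) else 0) *
            dpow x (m₁ + m₂ + n₁ + del0 i₂ - n)) := by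
        rw [Finset.mul_sum]
        refine Finset.sum_congr rfl fun n _ => ?_
        simp only [coeffLeft, hij, true_and]
        subst hij
        rw [e2, ← choose_neg_cast]
        split_ifs <;> push_cast <;> ring
    _ = _ := by
        rw [h, e3]
        linear_combination (dpow x m₁ * (-1) ^ m₂ * ((n₁ : F) * del0 i₂ + 1)) * (-h2) +
          (dpow x m₁ * (-1) ^ m₂ * dpow (x + l) m₂) * key

/-- The generating function of the scalars `coeffRight`. -/
theorem sum_coeffRight (l y : F) (i₁ i₂ j₁ j₂ : ZMod 2) (m₁ m₂ n₁ n₂ B : ℕ)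
    (hB : m₁ + m₂ + n₂ + del0 i₁ < B) :
    ∑ n ∈ Finset.range B, dpow l n *
      ((coeffRight n ((i₁, i₂), (m₁, m₂)) ((j₁, j₂), (n₁, n₂)) : ℤ) *
        dpow y (m₁ + m₂ + n₂ + del0 i₁ - n)) =
    if i₁ = j₂ then -(-1) ^ ((i₁ + i₂).val * (j₁ + j₂).val) *
      (dpow (y + l) n₂ * contr i₁ (-l - y) * dpow (-l - y) m₁ * dpow y m₂) else 0 := by
  by_cases hij : i₁ = j₂
  swap
  · simp [coeffRight, hij]
  have h := sum_dpow_choose l y m₂ (m₁ + n₂ + del0 i₁) B (by omega)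
  have e : m₂ + (m₁ + n₂ + del0 i₁) = m₁ + m₂ + n₂ + del0 i₁ := by ring
  rw [e] at h
  -- The minus sign in the index 0 case is what makes the factor `-l - y` rather than `y + l`.
  have key : ((del1 i₁ : F) - (n₂ + 1) * del0 i₁) * dpow (y + l) (n₂ + del0 i₁) =
      contr i₁ (-l - y) * dpow (y + l) n₂ := by
    have := dpow_succ (y + l) n₂
    by_cases h0 : i₁ = 0
    · simp only [del1, h0, del0, contr]
      simp only [zero_ne_one, ↓reduceIte, Nat.cast_zero, zero_sub, Nat.cast_one, mul_one]
      linear_combination -this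
    · have h1 : i₁ = 1 := by
        clear hij h e hB; revert h0; generalize i₁ = i; revert i; decide
      simp [del0, contr, del1, h1]
  have e2 : -(n₂ : ℤ) - 1 - del0 i₁ = -((n₂ + del0 i₁ : ℕ) : ℤ) - 1 := by push_cast; ring
  have e3 : m₁ + n₂ + del0 i₁ = n₂ + del0 i₁ + m₁ := by ring
  have h2 := dpow_mul (y + l) m₁ (n₂ + del0 i₁)
  rw [show m₁ + (n₂ + del0 i₁) = n₂ + del0 i₁ + m₁ by ring] at h2
  have e4 : dpow (-l - y) m₁ = (-1) ^ m₁ * dpow (y + l) m₁ := by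
    rw [← dpow_neg]; congr 1; ring
  rw [if_pos hij, e4]
  set s : F := (-1) ^ ((i₁ + i₂).val * (j₁ + j₂).val) with hs
  calc _ = -s * ((del1 i₁ : F) - (n₂ + 1) * del0 i₁) *
        ((-1) ^ m₁ * ((n₂ + del0 i₁ + m₁).choose m₁ : F)) *
        ∑ n ∈ Finset.range B, dpow l n *
          ((if n ≤ m₁ + m₂ + n₂ + del0 i₁ then
            ((m₁ + m₂ + n₂ + del0 i₁ - n).choose m₂ : F) else 0) *
            dpow y (m₁ + m₂ + n₂ + del0 i₁ - n)) := by
        rw [Finset.mul_sum]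
        refine Finset.sum_congr rfl fun n _ => ?_
        simp only [coeffRight, hij, true_and]
        subst hij
        rw [e2, ← choose_neg_cast]
        split_ifs <;> push_cast <;> ring
    _ = _ := by
        rw [h, e3]
        linear_combination (dpow y m₂ * (-1) ^ m₁ * (-s) *
          ((del1 i₁ : F) - (n₂ + 1) * del0 i₁)) * (-h2) +
          (-s * dpow y m₂ * (-1) ^ m₁ * dpow (y + l) m₁) * key

end Scalars

/-! ### Recovering coefficients from identities valid at all scalars. -/

section Extraction

variable {F X : Type*} [Field F] [CharZero F] [AddCommGroup X] [Module F X]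

/-- Every linear functional turns the hypothesis into a scalar polynomial vanishing on an infinite
field. Its coefficients are the values of the functional divided by nonzero factorials, and
functionals separate points. -/
theorem eq_zero_of_sum_dpow_eq_zero (f : ℕ → X) (N : ℕ)
    (h : ∀ x : F, ∑ n ∈ Finset.range N, dpow x n • f n = 0) (n : ℕ) (hn : n < N) : f n = 0 := by
  rw [← Module.forall_dual_apply_eq_zero_iff F]
  intro f'
  have hp : (∑ k ∈ Finset.range N,
      Polynomial.C (((k ! : ℕ) : F)⁻¹ * f' (f k)) * Polynomial.X ^ k) = 0 := by
    refine Polynomial.funext fun x => ?_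
    have := congrArg f' (h x)
    simp only [map_sum, map_smul, map_zero, smul_eq_mul, dpow] at this
    simp only [Polynomial.eval_finsetSum, Polynomial.eval_mul, Polynomial.eval_C,
      Polynomial.eval_pow, Polynomial.eval_X, Polynomial.eval_zero]
    rw [← this]
    exact Finset.sum_congr rfl fun k _ => by ring
  have hc := congrArg (fun p => Polynomial.coeff p n) hp
  simp only [Polynomial.finsetSum_coeff, Polynomial.coeff_C_mul_X_pow,
    Polynomial.coeff_zero] at hc
  rw [Finset.sum_ite_eq, if_pos (by simpa using hn)] at hc
  have h0 : ((n ! : ℕ) : F)⁻¹ ≠ 0 := inv_ne_zero (by exact_mod_cast n.factorial_ne_zero)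
  exact (mul_eq_zero.1 hc).resolve_left h0

theorem eq_of_sum_dpow_eq (f g : ℕ → X) (N : ℕ)
    (h : ∀ x : F, ∑ n ∈ Finset.range N, dpow x n • f n = ∑ n ∈ Finset.range N, dpow x n • g n)
    (n : ℕ) (hn : n < N) : f n = g n := by
  refine sub_eq_zero.1 (eq_zero_of_sum_dpow_eq_zero (F := F) (fun n => f n - g n) N (fun x => ?_)
    n hn)
  simp only [smul_sub, Finset.sum_sub_distrib]
  rw [h x, sub_self]

omit [Field F] [CharZero F] [Module F X] in
theorem sum_range_eq_of_le {f : ℕ → X} {N M : ℕ} (hf : ∀ n, N ≤ n → f n = 0) (h : N ≤ M) :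
    ∑ n ∈ Finset.range M, f n = ∑ n ∈ Finset.range N, f n := by
  refine (Finset.sum_subset (Finset.range_mono h) fun n _ hn => hf n ?_).symm
  simpa using hn

/-- Regrouping a finitely supported double sum by total degree; degrees below `2 * L` cover the
whole square. -/
theorem sum_antidiagonal_of_support (G : ℕ → ℕ → X) (L N : ℕ)
    (hG : ∀ l a, L ≤ l ∨ L ≤ a → G l a = 0) (hN : 2 * L ≤ N) :
    ∑ m ∈ Finset.range N, ∑ p ∈ Finset.HasAntidiagonal.antidiagonal m, G p.1 p.2 =
      ∑ l ∈ Finset.range L, ∑ a ∈ Finset.range L, G l a := by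
  rw [← Finset.sum_product', ← Finset.sum_fiberwise_of_maps_to
    (s := Finset.range L ×ˢ Finset.range L) (t := Finset.range N) (g := fun p => p.1 + p.2)]
  · refine Finset.sum_congr rfl fun m _ => (Finset.sum_subset ?_ ?_).symm
    · intro p hp
      exact Finset.HasAntidiagonal.mem_antidiagonal.2 (Finset.mem_filter.1 hp).2
    · intro p hp hp2
      rw [Finset.HasAntidiagonal.mem_antidiagonal] at hp
      refine hG _ _ ?_
      by_contra! hc
      exact hp2 (by simp [hp, hc.1, hc.2])
  · intro p hp
    simp only [Finset.mem_product, Finset.mem_range] at hp ⊢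
    omega

end Extraction

/-! ### Evaluation at scalars and the closed formula for the bracket. -/

section Evaluation

variable {F A : Type*} [Field F] [Ring A] [Algebra F A]

/-- The value at `(x, y)` of the polynomial attached to an element, where `u_{[i,j]}(m, n)` stands
for `x ^ m / m! * y ^ n / n!` times the matrix with the entry `u` at `(i, j)`. -/
def ev (x y : F) : Ambient A →ₗ[F] Matrix (ZMod 2) (ZMod 2) A :=
  Finsupp.lsum F fun a => (dpow x a.2.1 * dpow y a.2.2) • Matrix.singleLinearMap F a.1.1 a.1.2

theorem ev_elt (x y : F) (i j : ZMod 2) (m n : ℕ) (u : A) :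
    ev x y (elt i j m n u) = (dpow x m * dpow y n) • Matrix.single i j u := by
  simp [ev, elt, Matrix.singleLinearMap]

theorem elt_induction {p : Ambient A → Prop} (h0 : p 0) (hadd : ∀ u v, p u → p v → p (u + v))
    (h : ∀ i j m n a, p (elt i j m n a)) (u : Ambient A) : p u :=
  Finsupp.induction_linear u h0 hadd fun a b => h a.1.1 a.1.2 a.2.1 a.2.2 b

/-- The truncation bound does not depend on `x` and `y`, which is what allows coefficients to be
compared one variable at a time in `ev_injective`. -/
theorem ev_apply_eventually (u : Ambient A) : ∃ N₀ : ℕ, ∀ N, N₀ ≤ N → ∀ (x y : F) (i j : ZMod 2),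
    ev x y u i j = ∑ m ∈ Finset.range N, dpow x m •
      ∑ n ∈ Finset.range N, dpow y n • u ((i, j), (m, n)) := by
  induction u using elt_induction with
  | h0 => exact ⟨0, by simp⟩
  | hadd u v hu hv =>
    obtain ⟨N, hN⟩ := hu
    obtain ⟨M, hM⟩ := hv
    refine ⟨max N M, fun K hK x y i j => ?_⟩
    rw [map_add, Matrix.add_apply, hN K (le_trans (le_max_left _ _) hK),
      hM K (le_trans (le_max_right _ _) hK)]
    simp [smul_add, Finset.sum_add_distrib]
  | h i' j' m n a =>
    refine ⟨m + n + 1, fun N hN x y i j => ?_⟩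
    rw [ev_elt, Finset.sum_eq_single m, Finset.sum_eq_single n]
    · by_cases hi : i' = i
      · by_cases hj : j' = j
        · subst hi hj; simp [elt, mul_smul]
        · simp [elt, hj]
      · simp [elt, hi]
    · intro k _ hk
      simp [elt, hk.symm]
    · simp; omega
    · intro k _ hk
      simp [elt, hk.symm]
    · simp; omega

theorem ev_injective [CharZero F] {u v : Ambient A} (h : ∀ x y : F, ev x y u = ev x y v) :
    u = v := by
  refine sub_eq_zero.1 ?_
  have h' : ∀ x y : F, ev x y (u - v) = 0 := fun x y => by rw [map_sub, h, sub_self]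
  generalize u - v = w at h'
  obtain ⟨N, hN⟩ := ev_apply_eventually (F := F) w
  ext ⟨⟨i, j⟩, m, n⟩
  set M := N + m + n + 1
  refine eq_zero_of_sum_dpow_eq_zero (F := F) (fun n => w ((i, j), (m, n))) M (fun y => ?_) n
    (by omega)
  refine eq_zero_of_sum_dpow_eq_zero (F := F)
    (fun m => ∑ n ∈ Finset.range M, dpow y n • w ((i, j), (m, n))) M (fun x => ?_) m (by omega)
  rw [← hN M (by omega), h']
  rfl

/-- In divided powers, raising an exponent with its factor `m + 1` is multiplication by the
variable. -/
theorem ev_D [CharZero F] (x y : F) (u : Ambient A) : ev x y (D F u) = (x + y) • ev x y u := by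
  induction u using elt_induction with
  | h0 => simp
  | hadd u v hu hv => rw [map_add, map_add, hu, hv, map_add, smul_add]
  | h i j m n a =>
    rw [D_elt, map_add, map_smul, map_smul, ev_elt, ev_elt, ev_elt, smul_smul, smul_smul,
      smul_smul, ← add_smul]
    congr 1
    linear_combination dpow y n * dpow_succ x m + dpow x m * dpow_succ y n

theorem ev_D_pow [CharZero F] (x y : F) (u : Ambient A) (l : ℕ) :
    ev x y ((D F ^ l) u) = (x + y) ^ l • ev x y u := by
  induction l with
  | zero => simp
  | succ l ih => rw [pow_succ', Module.End.mul_apply, ev_D, ih, smul_smul, pow_succ']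

/-- The generating function `∑ₙ l ^ n / n! • uₙ v` of the products. -/
def bracket (l : F) : Ambient A →ₗ[F] Ambient A →ₗ[F] Ambient A :=
  Finsupp.lsum F fun a => (Finsupp.lsum F fun b =>
    (∑ n ∈ Finset.range (a.2.1 + a.2.2 + b.2.1 + b.2.2 + 2),
      dpow l n • basicMul F n a b).flip).flip

theorem mul_elt_eq_zero (i₁ i₂ j₁ j₂ : ZMod 2) (m₁ m₂ n₁ n₂ n : ℕ) (u v : A)
    (hn : m₁ + m₂ + n₁ + n₂ + 2 ≤ n) : mul F n (elt i₁ i₂ m₁ m₂ u) (elt j₁ j₂ n₁ n₂ v) = 0 := by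
  have h (i : ZMod 2) : del0 i ≤ 1 := by unfold del0; split_ifs <;> simp
  have h1 := h i₁
  have h2 := h i₂
  rw [mul_elt]
  simp only [coeffLeft, coeffRight]
  rw [if_neg (by omega), if_neg (by omega)]
  simp

theorem bracket_elt (l : F) (i₁ i₂ j₁ j₂ : ZMod 2) (m₁ m₂ n₁ n₂ : ℕ) (u v : A) :
    bracket l (elt i₁ i₂ m₁ m₂ u) (elt j₁ j₂ n₁ n₂ v) =
      ∑ n ∈ Finset.range (m₁ + m₂ + n₁ + n₂ + 2),
        dpow l n • mul F n (elt i₁ i₂ m₁ m₂ u) (elt j₁ j₂ n₁ n₂ v) := by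
  simp [bracket, elt, mul, LinearMap.sum_apply]

/-- `bracket` is built with a cutoff depending on the basis indices so that it is bilinear by
construction. Stating the comparison for all large `N` makes it additive in each argument. -/
theorem exists_bracket_eq (u v : Ambient A) : ∃ N₀ : ℕ, ∀ N, N₀ ≤ N →
    mul F N u v = 0 ∧ ∀ l : F, bracket l u v = ∑ n ∈ Finset.range N, dpow l n • mul F n u v := by
  induction u using elt_induction with
  | h0 => exact ⟨0, by simp⟩
  | hadd u u' hu hu' =>
    obtain ⟨N, hN⟩ := hu
    obtain ⟨M, hM⟩ := hu'
    refine ⟨max N M, fun K hK => ?_⟩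
    obtain ⟨h1, h2⟩ := hN K (le_trans (le_max_left _ _) hK)
    obtain ⟨h3, h4⟩ := hM K (le_trans (le_max_right _ _) hK)
    refine ⟨by simp [h1, h3], fun l => ?_⟩
    simp [h2 l, h4 l, Finset.sum_add_distrib]
  | h i₁ i₂ m₁ m₂ a =>
    induction v using elt_induction with
    | h0 => exact ⟨0, by simp⟩
    | hadd u u' hu hu' =>
      obtain ⟨N, hN⟩ := hu
      obtain ⟨M, hM⟩ := hu'
      refine ⟨max N M, fun K hK => ?_⟩
      obtain ⟨h1, h2⟩ := hN K (le_trans (le_max_left _ _) hK)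
      obtain ⟨h3, h4⟩ := hM K (le_trans (le_max_right _ _) hK)
      refine ⟨by simp [h1, h3], fun l => ?_⟩
      simp [h2 l, h4 l, Finset.sum_add_distrib]
    | h j₁ j₂ n₁ n₂ b =>
      refine ⟨m₁ + m₂ + n₁ + n₂ + 2, fun N hN => ⟨mul_elt_eq_zero _ _ _ _ _ _ _ _ _ _ _ hN,
        fun l => ?_⟩⟩
      rw [bracket_elt, sum_range_eq_of_le (fun n hn => ?_) hN]
      rw [mul_elt_eq_zero _ _ _ _ _ _ _ _ _ _ _ hn, smul_zero]

theorem exists_mul_eq_zero (u v : Ambient A) : ∃ N : ℕ, ∀ n, N ≤ n → mul F n u v = 0 :=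
  (exists_bracket_eq u v).imp fun _ h n hn => (h n hn).1

theorem bracket_eq_sum (u v : Ambient A) (N : ℕ) (hN : ∀ n, N ≤ n → mul F n u v = 0) (l : F) :
    bracket l u v = ∑ n ∈ Finset.range N, dpow l n • mul F n u v := by
  obtain ⟨N₀, h⟩ := exists_bracket_eq (F := F) u v
  rw [(h (max N N₀) (le_max_right _ _)).2 l,
    sum_range_eq_of_le (fun n hn => by rw [hN n hn, smul_zero]) (le_max_left _ _)]

/-- The diagonal matrix of the contraction factors. -/
def contrMatrix (A : Type*) [Ring A] [Algebra F A] (s : F) : Matrix (ZMod 2) (ZMod 2) A :=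
  Matrix.diagonal fun i => algebraMap F A (contr i s)

theorem single_contrMatrix_single (s : F) (i j k l : ZMod 2) (u v : A) :
    Matrix.single i j u * contrMatrix A s * Matrix.single k l v =
      if j = k then contr j s • Matrix.single i l (u * v) else 0 := by
  have : Matrix.single i j u * contrMatrix A s = contr j s • Matrix.single i j u := by
    ext a b
    rw [contrMatrix, Matrix.mul_diagonal]
    by_cases ha : i = a
    · by_cases hb : j = b
      · subst ha hb; simp [Algebra.smul_def, Algebra.commutes]
      · simp [hb]
    · simp [ha]
  rw [this, Matrix.smul_mul]
  split_ifs with h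
  · subst h; simp
  · rw [Matrix.single_mul_single_of_ne _ _ _ _ h, smul_zero]

/-- The part of parity `i` of the space `M₂(A) ⊗ F[t₁, t₂]`. -/
def parityPart (F A : Type*) [Field F] [Ring A] [Algebra F A] (i : ZMod 2) :
    Submodule F (Ambient A) :=
  Submodule.span F {x | ∃ (i₁ i₂ : ZMod 2) (m n : ℕ) (u : A), i₁ + i₂ = i ∧ x = elt i₁ i₂ m n u}

theorem parityPart_induction {i : ZMod 2} {p : Ambient A → Prop} (h0 : p 0)
    (hadd : ∀ u v, p u → p v → p (u + v))
    (h : ∀ i₁ i₂ m n a, i₁ + i₂ = i → p (elt i₁ i₂ m n a)) {u : Ambient A}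
    (hu : u ∈ parityPart F A i) : p u := by
  -- Carrying all scalar multiples removes the need for a scalar case: a multiple of `elt` is again
  -- an `elt`.
  suffices H : ∀ c : F, p (c • u) by simpa using H 1
  induction hu using Submodule.span_induction with
  | mem x hx =>
    obtain ⟨i₁, i₂, m, n, u, hi, rfl⟩ := hx
    intro c
    simpa [elt] using h i₁ i₂ m n (c • u) hi
  | zero => simpa using h0
  | add x y _ _ hx hy => exact fun c => by rw [smul_add]; exact hadd _ _ (hx c) (hy c)
  | smul a x _ hx => exact fun c => by rw [smul_smul]; exact hx _

/-- By bilinearity only basis elements matter. There `sum_coeffLeft` and `sum_coeffRight` sum the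
scalars, and the Kronecker symbols are those of multiplying matrix units with a diagonal matrix in
between. -/
theorem ev_bracket [CharZero F] {i j : ZMod 2} {u v : Ambient A} (hu : u ∈ parityPart F A i)
    (hv : v ∈ parityPart F A j) (l x y : F) :
    ev x y (bracket l u v) =
      ev x (-l - x) u * contrMatrix A (x + l) * ev (x + l) y v -
      ((-1 : F) ^ (i.val * j.val)) •
        (ev x (y + l) v * contrMatrix A (-l - y) * ev (-l - y) y u) := by
  refine parityPart_induction (p := fun u => ev x y (bracket l u v) =
      ev x (-l - x) u * contrMatrix A (x + l) * ev (x + l) y v -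
      ((-1 : F) ^ (i.val * j.val)) •
        (ev x (y + l) v * contrMatrix A (-l - y) * ev (-l - y) y u))
    (by simp) (fun u u' hu hu' => ?_) (fun i₁ i₂ m₁ m₂ a hi => ?_) hu
  · simp only [map_add, LinearMap.add_apply, hu, hu', add_mul, mul_add, smul_add]
    abel
  · refine parityPart_induction (p := fun v => ev x y (bracket l (elt i₁ i₂ m₁ m₂ a) v) =
      ev x (-l - x) (elt i₁ i₂ m₁ m₂ a) * contrMatrix A (x + l) * ev (x + l) y v -
      ((-1 : F) ^ (i.val * j.val)) •
        (ev x (y + l) v * contrMatrix A (-l - y) * ev (-l - y) y (elt i₁ i₂ m₁ m₂ a)))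
      (by simp) (fun u u' hu hu' => ?_) (fun j₁ j₂ n₁ n₂ b hj => ?_) hv
    · simp only [map_add, hu, hu', add_mul, mul_add, smul_add]
      abel
    · have h (i : ZMod 2) : del0 i ≤ 1 := by unfold del0; split_ifs <;> simp
      have h1 := h i₁
      have h2 := h i₂
      have eL := sum_coeffLeft l x i₁ i₂ j₁ j₂ m₁ m₂ n₁ n₂ (m₁ + m₂ + n₁ + n₂ + 2) (by omega)
      have eR := sum_coeffRight l y i₁ i₂ j₁ j₂ m₁ m₂ n₁ n₂ (m₁ + m₂ + n₁ + n₂ + 2) (by omega)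
      rw [bracket_elt, map_sum]
      simp only [map_smul, mul_elt, map_add, ev_elt, smul_add, smul_smul,
        Finset.sum_add_distrib]
      have e1 : ∀ n ∈ Finset.range (m₁ + m₂ + n₁ + n₂ + 2),
          (dpow l n * ((coeffLeft n ((i₁, i₂), (m₁, m₂)) ((j₁, j₂), (n₁, n₂)) : ℤ) : F) *
            (dpow x (m₁ + m₂ + n₁ + del0 i₂ - n) * dpow y n₂)) • Matrix.single i₁ j₂ (a * b) =
          (dpow l n * (((coeffLeft n ((i₁, i₂), (m₁, m₂)) ((j₁, j₂), (n₁, n₂)) : ℤ) : F) *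
            dpow x (m₁ + m₂ + n₁ + del0 i₂ - n))) • (dpow y n₂ • Matrix.single i₁ j₂ (a * b)) := by
        intro n _; rw [smul_smul]; congr 1; ring
      have e2 : ∀ n ∈ Finset.range (m₁ + m₂ + n₁ + n₂ + 2),
          (dpow l n * ((coeffRight n ((i₁, i₂), (m₁, m₂)) ((j₁, j₂), (n₁, n₂)) : ℤ) : F) *
            (dpow x n₁ * dpow y (m₁ + m₂ + n₂ + del0 i₁ - n))) • Matrix.single j₁ i₂ (b * a) =
          (dpow l n * (((coeffRight n ((i₁, i₂), (m₁, m₂)) ((j₁, j₂), (n₁, n₂)) : ℤ) : F) *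
            dpow y (m₁ + m₂ + n₂ + del0 i₁ - n))) • (dpow x n₁ • Matrix.single j₁ i₂ (b * a)) := by
        intro n _; rw [smul_smul]; congr 1; ring
      rw [Finset.sum_congr rfl e1, Finset.sum_congr rfl e2, ← Finset.sum_smul, ← Finset.sum_smul,
        eL, eR, hi, hj]
      simp only [smul_mul_assoc, mul_smul_comm, single_contrMatrix_single, smul_smul]
      refine (congrArg₂ (· + ·) ?_ ?_).trans (sub_eq_add_neg _ _).symm
      · by_cases hij : i₂ = j₁
        · simp only [hij, if_true, smul_smul]; congr 1; ring
        · simp [hij]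
      · by_cases hij : i₁ = j₂
        · subst hij; simp only [if_true, smul_smul, ← neg_smul]; congr 1; ring
        · simp [hij, Ne.symm hij]

end Evaluation

/-! ### The axioms of a conformal superalgebra on the ambient space. -/

section Identities

variable {F A : Type*} [Field F] [Ring A] [Algebra F A]

theorem elt_mem_parityPart (i₁ i₂ : ZMod 2) (m n : ℕ) (u : A) :
    elt i₁ i₂ m n u ∈ parityPart F A (i₁ + i₂) :=
  Submodule.subset_span ⟨i₁, i₂, m, n, u, rfl, rfl⟩

theorem D_mem_parityPart {i : ZMod 2} {u : Ambient A} (hu : u ∈ parityPart F A i) :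
    D F u ∈ parityPart F A i := by
  refine parityPart_induction (p := fun u => D F u ∈ parityPart F A i) (by simp)
    (fun u v hu hv => by rw [map_add]; exact add_mem hu hv) (fun i₁ i₂ m n a hi => ?_) hu
  subst hi
  rw [D_elt]
  exact add_mem (Submodule.smul_mem _ _ (elt_mem_parityPart _ _ _ _ _))
    (Submodule.smul_mem _ _ (elt_mem_parityPart _ _ _ _ _))

theorem mul_mem_parityPart {i j : ZMod 2} {u v : Ambient A} (hu : u ∈ parityPart F A i)
    (hv : v ∈ parityPart F A j) (n : ℕ) : mul F n u v ∈ parityPart F A (i + j) := by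
  refine parityPart_induction (p := fun u => mul F n u v ∈ parityPart F A (i + j)) (by simp)
    (fun u v hu hv => by rw [map_add]; exact add_mem hu hv) (fun i₁ i₂ m₁ m₂ a hi => ?_) hu
  refine parityPart_induction
    (p := fun v => mul F n (elt i₁ i₂ m₁ m₂ a) v ∈ parityPart F A (i + j)) (by simp)
    (fun u v hu hv => by rw [map_add]; exact add_mem hu hv) (fun j₁ j₂ n₁ n₂ b hj => ?_) hv
  subst hi hj
  rw [mul_elt]
  refine add_mem ?_ ?_
  · by_cases h : i₂ = j₁
    · subst h
      have h2 : i₁ + i₂ + (i₂ + j₂) = i₁ + j₂ := by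
        generalize i₁ = a, i₂ = b, j₂ = c; revert a b c; decide
      rw [h2]
      exact Submodule.smul_mem _ _ (elt_mem_parityPart _ _ _ _ _)
    · simp [coeffLeft, h]
  · by_cases h : i₁ = j₂
    · subst h
      have h2 : i₁ + i₂ + (j₁ + i₁) = j₁ + i₂ := by
        generalize i₁ = a, i₂ = b, j₁ = c; revert a b c; decide
      rw [h2]
      exact Submodule.smul_mem _ _ (elt_mem_parityPart _ _ _ _ _)
    · simp [coeffRight, h]

theorem bracket_mem_parityPart {i j : ZMod 2} {u v : Ambient A} (hu : u ∈ parityPart F A i)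
    (hv : v ∈ parityPart F A j) (l : F) : bracket l u v ∈ parityPart F A (i + j) := by
  obtain ⟨N, hN⟩ := exists_mul_eq_zero (F := F) u v
  rw [bracket_eq_sum u v N hN]
  exact Submodule.sum_mem _ fun n _ => Submodule.smul_mem _ _ (mul_mem_parityPart hu hv n)

theorem sup_parityPart : parityPart F A 0 ⊔ parityPart F A 1 = ⊤ := by
  refine eq_top_iff.2 fun u _ => ?_
  induction u using elt_induction with
  | h0 => exact zero_mem _
  | hadd u v hu hv => exact add_mem (hu trivial) (hv trivial)
  | h i j m n a =>
    have h := elt_mem_parityPart (F := F) i j m n a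
    have h2 : i + j = 0 ∨ i + j = 1 := by generalize i + j = k; revert k; decide
    rcases h2 with h2 | h2
    · rw [h2] at h; exact Submodule.mem_sup_left h
    · rw [h2] at h; exact Submodule.mem_sup_right h

theorem apply_eq_zero_of_mem_parityPart {i : ZMod 2} {u : Ambient A}
    (hu : u ∈ parityPart F A i) (a : (ZMod 2 × ZMod 2) × (ℕ × ℕ)) (ha : a.1.1 + a.1.2 ≠ i) :
    u a = 0 := by
  refine parityPart_induction (p := fun u => u a = 0) (by simp)
    (fun u v hu hv => by simp [hu, hv]) (fun i₁ i₂ m n b hi => ?_) hu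
  refine Finsupp.single_eq_of_ne ?_
  rintro rfl
  exact ha hi

theorem disjoint_parityPart : Disjoint (parityPart F A 0) (parityPart F A 1) := by
  refine Submodule.disjoint_def.2 fun u h0 h1 => ?_
  ext a
  by_cases h : a.1.1 + a.1.2 = 0
  · exact apply_eq_zero_of_mem_parityPart h1 a (by rw [h]; decide)
  · exact apply_eq_zero_of_mem_parityPart h0 a h

variable [CharZero F]

/-- In both terms of `ev_bracket` the two arguments of `u` add up to `-l`. -/
theorem bracket_D (l : F) (u v : Ambient A) : bracket l (D F u) v = -l • bracket l u v := by
  have key : ∀ i j : ZMod 2, ∀ u ∈ parityPart F A i, ∀ v ∈ parityPart F A j,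
      bracket l (D F u) v = -l • bracket l u v := by
    intro i j u hu v hv
    refine ev_injective (F := F) fun x y => ?_
    rw [map_smul, ev_bracket (D_mem_parityPart hu) hv, ev_bracket hu hv, ev_D, ev_D]
    simp only [smul_mul_assoc, mul_smul_comm, smul_sub, smul_smul]
    congr 2 <;> ring
  obtain ⟨u₀, hu₀, u₁, hu₁, rfl⟩ := Submodule.mem_sup.1
    (show u ∈ parityPart F A 0 ⊔ parityPart F A 1 by rw [sup_parityPart]; trivial)
  obtain ⟨v₀, hv₀, v₁, hv₁, rfl⟩ := Submodule.mem_sup.1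
    (show v ∈ parityPart F A 0 ⊔ parityPart F A 1 by rw [sup_parityPart]; trivial)
  simp only [map_add, LinearMap.add_apply, key 0 0 _ hu₀ _ hv₀, key 0 1 _ hu₀ _ hv₁,
    key 1 0 _ hu₁ _ hv₀, key 1 1 _ hu₁ _ hv₁, smul_add]

theorem mul_D (u v : Ambient A) : mul F 0 (D F u) v = 0 ∧
    ∀ n : ℕ, mul F (n + 1) (D F u) v = (-((n : F) + 1)) • mul F n u v := by
  obtain ⟨N, hN⟩ := exists_mul_eq_zero (F := F) u v
  obtain ⟨M, hM⟩ := exists_mul_eq_zero (F := F) (D F u) v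
  have key : ∀ n, mul F n (D F u) v = if n = 0 then 0 else (-(n : F)) • mul F (n - 1) u v := by
    intro n
    have hb : n < N + M + n + 1 + 1 := by omega
    refine eq_of_sum_dpow_eq (F := F) (fun n => mul F n (D F u) v)
      (fun n => if n = 0 then 0 else (-(n : F)) • mul F (n - 1) u v) _ (fun l => ?_) n hb
    rw [← bracket_eq_sum _ _ _ (fun k hk => hM k (by omega)), bracket_D,
      bracket_eq_sum u v (N + M + n + 1) (fun k hk => hN k (by omega)),
      Finset.sum_range_succ' _ (N + M + n + 1), Finset.smul_sum]
    simp only [Nat.add_eq_zero_iff, one_ne_zero, and_false, ↓reduceIte, smul_zero, add_zero,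
      Nat.add_sub_cancel, smul_smul]
    refine Finset.sum_congr rfl fun k _ => ?_
    congr 1
    push_cast
    linear_combination dpow_succ l k
  refine ⟨by simpa using key 0, fun n => ?_⟩
  have := key (n + 1)
  simpa using this

/-- Replacing `l` by `-l - (x + y)` and swapping `u` with `v` exchanges the two terms of
`ev_bracket`, contraction factors included. -/
theorem ev_bracket_skew {i j : ZMod 2} {u v : Ambient A} (hu : u ∈ parityPart F A i)
    (hv : v ∈ parityPart F A j) (l x y : F) :
    ev x y (bracket l u v) =
      -((-1 : F) ^ (i.val * j.val) • ev x y (bracket (-l - (x + y)) v u)) := by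
  rw [ev_bracket hu hv, ev_bracket hv hu]
  have e1 : -(-l - (x + y)) - x = y + l := by ring
  have e2 : x + (-l - (x + y)) = -l - y := by ring
  have e3 : y + (-l - (x + y)) = -l - x := by ring
  have e4 : -(-l - (x + y)) - y = x + l := by ring
  rw [e1, e2, e3, e4, smul_sub, smul_smul, mul_comm j.val, ← mul_pow]
  simp

/-- Expand `dpow (-(z + (x + y)))` by the binomial theorem, read powers of `x + y` as powers of ∂,
and compare coefficients of `z`. -/
theorem mul_skew {i j : ZMod 2} {u v : Ambient A} (hu : u ∈ parityPart F A i)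
    (hv : v ∈ parityPart F A j) (n N : ℕ) (hN : ∀ m, N ≤ m → mul F m v u = 0) :
    mul F n u v = ((-1 : F) ^ (i.val * j.val)) • ∑ l ∈ Finset.range N,
      ((-1 : F) ^ (n + l + 1) * ((l ! : ℕ) : F)⁻¹) • (D F ^ l) (mul F (n + l) v u) := by
  obtain ⟨M, hM⟩ := exists_mul_eq_zero (F := F) u v
  refine ev_injective (F := F) fun x y => ?_
  set s : F := (-1 : F) ^ (i.val * j.val)
  -- Large enough to contain the index `n`, the total degrees up to `2 * N`, and all nonzero
  -- products of `u` and `v`.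
  set K := n + N + N + M + 1
  refine eq_of_sum_dpow_eq (F := F) (fun n => ev x y (mul F n u v))
      (fun n => ev x y (s • ∑ l ∈ Finset.range N,
      ((-1 : F) ^ (n + l + 1) * ((l ! : ℕ) : F)⁻¹) • (D F ^ l) (mul F (n + l) v u))) K
      (fun z => ?_) n (by omega)
  have h1 : ∑ n ∈ Finset.range K, dpow z n • ev x y (mul F n u v) = ev x y (bracket z u v) := by
    rw [bracket_eq_sum u v K (fun k hk => hM k (by omega)), map_sum]
    simp only [map_smul]
  rw [h1, ev_bracket_skew hu hv, bracket_eq_sum v u K (fun k hk => hN k (by omega)), map_sum]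
  have e : -z - (x + y) = -(z + (x + y)) := by ring
  simp only [map_smul, e, dpow_neg, dpow_add z (x + y), map_sum, ev_D_pow, smul_smul,
    Finset.mul_sum, Finset.sum_smul, Finset.smul_sum]
  have h2 := sum_antidiagonal_of_support
    (fun a l => -(s • (((-1 : F) ^ (a + l) * (dpow z a * dpow (x + y) l)) •
      ev x y (mul F (a + l) v u)))) N K (fun l a h => by
        rw [hN _ (by omega)]; simp) (by omega)
  have h3 : ∀ (k : ℕ), N ≤ k → ∀ l, mul F (k + l) v u = 0 := fun k hk l => hN _ (by omega)
  rw [← Finset.sum_neg_distrib]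
  refine Eq.trans ?_ (sum_range_eq_of_le (fun n hn => Finset.sum_eq_zero fun l _ => by
    rw [h3 n hn, map_zero, smul_zero]) (show N ≤ K by omega)).symm
  refine Eq.trans (Finset.sum_congr rfl fun m _ => ?_) (h2.trans (Finset.sum_congr rfl
    fun a _ => Finset.sum_congr rfl fun l _ => ?_))
  · rw [← Finset.sum_neg_distrib]
    refine Finset.sum_congr rfl fun p hp => ?_
    have hp := Finset.HasAntidiagonal.mem_antidiagonal.1 hp
    rw [hp, smul_smul, ← mul_assoc]
  · rw [smul_smul, ← neg_smul]
    congr 1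
    simp only [dpow]
    ring

omit [CharZero F] in
theorem neg_one_pow_val_mul_add (i j k : ZMod 2) :
    (-1 : F) ^ (i.val * (j + k).val) = (-1) ^ (i.val * j.val) * (-1) ^ (i.val * k.val) := by
  have h : ((-1 : ℤ)) ^ (i.val * (j + k).val) =
      (-1) ^ (i.val * j.val) * (-1) ^ (i.val * k.val) := by
    revert i j k; decide
  exact_mod_cast congrArg (Int.cast : ℤ → F) h

omit [CharZero F] in
theorem neg_one_pow_val_add_mul (i j k : ZMod 2) :
    (-1 : F) ^ ((i + j).val * k.val) = (-1) ^ (i.val * k.val) * (-1) ^ (j.val * k.val) := by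
  rw [mul_comm, neg_one_pow_val_mul_add, mul_comm k.val, mul_comm k.val]

/-- After evaluation each bracket is a supercommutator of associative products. The orders u w v and
v w u cancel on the left, and the remaining four terms match the right side once the shifted
arguments are identified. -/
theorem bracket_jacobi {i j : ZMod 2} {u v : Ambient A} (hu : u ∈ parityPart F A i)
    (hv : v ∈ parityPart F A j) (w : Ambient A) (l m : F) :
    bracket l u (bracket m v w) - ((-1 : F) ^ (i.val * j.val)) • bracket m v (bracket l u w) =
      bracket (l + m) (bracket l u v) w := by
  have key : ∀ k : ZMod 2, ∀ w ∈ parityPart F A k,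
      bracket l u (bracket m v w) - ((-1 : F) ^ (i.val * j.val)) • bracket m v (bracket l u w) =
        bracket (l + m) (bracket l u v) w := by
    intro k w hw
    refine ev_injective (F := F) fun x y => ?_
    have e1 : -(l + m) - x + l = -m - x := by ring
    have e2 : -l - (-(l + m) - x) = x + m := by ring
    have e3 : -l - (x + m) = -(l + m) - x := by ring
    have e4 : -m - (x + l) = -(l + m) - x := by ring
    have e5 : -l - (-(l + m) - y) = y + m := by ring
    have e6 : -(l + m) - y + l = -m - y := by ring
    have e7 : -m - (y + l) = -(l + m) - y := by ring
    have e8 : -l - (y + m) = -(l + m) - y := by ring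
    have e9 : x + l + m = x + (l + m) := by ring
    have e10 : x + m + l = x + (l + m) := by ring
    have e11 : y + l + m = y + (l + m) := by ring
    have e12 : y + m + l = y + (l + m) := by ring
    have hs : (-1 : F) ^ (i.val * j.val) = 1 ∨ (-1 : F) ^ (i.val * j.val) = -1 :=
      neg_one_pow_eq_or F _
    simp only [map_sub, map_smul, ev_bracket hu (bracket_mem_parityPart hv hw m),
      ev_bracket hv (bracket_mem_parityPart hu hw l), ev_bracket hu hw, ev_bracket hv hw,
      ev_bracket hu hv, ev_bracket (bracket_mem_parityPart hu hv l) hw, e1, e2, e3, e4, e5, e6,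
      e7, e8, e9, e10, e11, e12, neg_one_pow_val_mul_add, neg_one_pow_val_add_mul,
      mul_comm j.val i.val]
    generalize (-1 : F) ^ (i.val * j.val) = a at hs ⊢
    generalize (-1 : F) ^ (i.val * k.val) = b
    generalize (-1 : F) ^ (j.val * k.val) = c
    simp only [mul_sub, sub_mul, smul_sub, mul_smul_comm, smul_mul_assoc, smul_smul, mul_assoc]
    -- The cancellation uses that the sign `a` squares to 1; the signs `b` and `c` can stay
    -- arbitrary.
    rcases hs with rfl | rfl <;> module
  obtain ⟨w₀, hw₀, w₁, hw₁, rfl⟩ := Submodule.mem_sup.1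
    (show w ∈ parityPart F A 0 ⊔ parityPart F A 1 by rw [sup_parityPart]; trivial)
  simp only [map_add]
  rw [← key 0 _ hw₀, ← key 1 _ hw₁]
  simp only [smul_add]
  abel

omit [Field F] [CharZero F] [Ring A] [Algebra F A] in
theorem exists_uniform_bound {P : ℕ → ℕ → Prop} (h : ∀ l, ∃ N, ∀ k, N ≤ k → P k l) (L : ℕ)
    (hL : ∀ l, L ≤ l → ∀ k, P k l) : ∃ N, ∀ k, N ≤ k → ∀ l, P k l := by
  choose f hf using h
  refine ⟨∑ l ∈ Finset.range L, f l, fun k hk l => ?_⟩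
  by_cases hl : L ≤ l
  · exact hL l hl k
  · exact hf l k ((Finset.single_le_sum (f := f) (fun _ _ => Nat.zero_le _)
      (Finset.mem_range.2 (not_le.1 hl))).trans hk)

omit [CharZero F] in
/-- A bound beyond which all the products `uₘ(vₙw)` vanish. -/
theorem exists_mul_mul_eq_zero (u v w : Ambient A) : ∃ N : ℕ, ∀ k, N ≤ k →
    ∀ l, mul F k v w = 0 ∧ mul F k u (mul F l v w) = 0 := by
  obtain ⟨L, hL⟩ := exists_mul_eq_zero (F := F) v w
  obtain ⟨M, hM⟩ := exists_uniform_bound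
    (fun l => exists_mul_eq_zero (F := F) u (mul F l v w)) L
    (fun l hl k => by rw [hL l hl, map_zero])
  exact ⟨L + M, fun k hk l => ⟨hL k (by omega), hM k (by omega) l⟩⟩

omit [CharZero F] in
theorem bracket_bracket_eq_sum (u v w : Ambient A) (K : ℕ)
    (hK : ∀ k, K ≤ k → ∀ l, mul F k v w = 0 ∧ mul F k u (mul F l v w) = 0) (x y : F) :
    bracket x u (bracket y v w) = ∑ n ∈ Finset.range K, ∑ m ∈ Finset.range K,
      dpow y n • dpow x m • mul F m u (mul F n v w) := by
  rw [bracket_eq_sum v w K (fun k hk => (hK k hk 0).1), map_sum]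
  refine Finset.sum_congr rfl fun n _ => ?_
  rw [map_smul, bracket_eq_sum u _ K (fun k hk => (hK k hk n).2), Finset.smul_sum]

/-- Coefficient comparison in `bracket_jacobi`. The factor `dpow (x + y)` is expanded, and the
binomial coefficient of the axiom comes from multiplying `dpow x l` by `dpow x a` with `l + a = m`.
-/
theorem mul_jacobi {i j : ZMod 2} {u v : Ambient A} (hu : u ∈ parityPart F A i)
    (hv : v ∈ parityPart F A j) (m n : ℕ) (w : Ambient A) :
    mul F m u (mul F n v w) - ((-1 : F) ^ (i.val * j.val)) • mul F n v (mul F m u w) =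
      ∑ l ∈ Finset.range (m + 1), ((m.choose l : ℕ) : F) • mul F (m + n - l) (mul F l u v) w := by
  obtain ⟨N₁, h₁⟩ := exists_mul_mul_eq_zero (F := F) u v w
  obtain ⟨N₂, h₂⟩ := exists_mul_mul_eq_zero (F := F) v u w
  obtain ⟨L₁, h₃⟩ := exists_mul_eq_zero (F := F) u v
  obtain ⟨L₂, h₄⟩ : ∃ N, ∀ k, N ≤ k → ∀ l, mul F k (mul F l u v) w = 0 := by
    refine exists_uniform_bound (fun l => exists_mul_eq_zero (F := F) (mul F l u v) w) L₁ ?_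
    intro l hl k
    rw [h₃ l hl]; simp
  set s : F := (-1 : F) ^ (i.val * j.val)
  set L := L₁ + L₂
  set K := N₁ + N₂ + L + L + m + n + 1
  refine eq_of_sum_dpow_eq (F := F) (fun n => mul F m u (mul F n v w) - s • mul F n v (mul F m u w))
    (fun n => ∑ l ∈ Finset.range (m + 1),
      ((m.choose l : ℕ) : F) • mul F (m + n - l) (mul F l u v) w) K (fun y => ?_) n (by omega)
  refine eq_of_sum_dpow_eq (F := F)
    (fun m => ∑ n ∈ Finset.range K, dpow y n •
      (mul F m u (mul F n v w) - s • mul F n v (mul F m u w)))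
    (fun m => ∑ n ∈ Finset.range K, dpow y n • ∑ l ∈ Finset.range (m + 1),
      ((m.choose l : ℕ) : F) • mul F (m + n - l) (mul F l u v) w) K (fun x => ?_) m (by omega)
  have hb := bracket_jacobi hu hv w x y
  rw [bracket_bracket_eq_sum u v w K (fun k hk => h₁ k (by omega)),
    bracket_bracket_eq_sum v u w K (fun k hk => h₂ k (by omega))] at hb
  have hl : ∑ m ∈ Finset.range K, dpow x m • ∑ n ∈ Finset.range K, dpow y n •
      (mul F m u (mul F n v w) - s • mul F n v (mul F m u w)) =
      bracket (x + y) (bracket x u v) w := by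
    rw [← hb]
    simp only [smul_sub, Finset.sum_sub_distrib, Finset.smul_sum]
    refine congrArg₂ (· - ·) ?_ ?_
    · rw [Finset.sum_comm]
      refine Finset.sum_congr rfl fun a _ => Finset.sum_congr rfl fun b _ => ?_
      exact smul_comm _ _ _
    · refine Finset.sum_congr rfl fun a _ => Finset.sum_congr rfl fun b _ => ?_
      rw [smul_smul, smul_smul, smul_smul, smul_smul]
      exact congrArg (· • mul F b v (mul F a u w)) (by ring)
  rw [hl, bracket_eq_sum u v L (fun k hk => h₃ k (by omega)), map_sum, LinearMap.sum_apply]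
  have hr : ∀ l, bracket (x + y) (dpow x l • mul F l u v) w =
      ∑ a ∈ Finset.range L, ∑ n ∈ Finset.range L,
        (dpow x l * dpow x a * dpow y n) • mul F (a + n) (mul F l u v) w := by
    intro l
    rw [map_smul, LinearMap.smul_apply, bracket_eq_sum (mul F l u v) w K
      (fun k hk => h₄ k (by omega) l)]
    simp only [dpow_add x y, Finset.sum_smul, Finset.smul_sum, smul_smul]
    rw [← sum_antidiagonal_of_support (fun a n => (dpow x l * dpow x a * dpow y n) •
      mul F (a + n) (mul F l u v) w) L K (fun a n h => by rw [h₄ _ (by omega), smul_zero])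
      (by omega)]
    refine Finset.sum_congr rfl fun a _ => Finset.sum_congr rfl fun p hp => ?_
    rw [Finset.HasAntidiagonal.mem_antidiagonal.1 hp, mul_assoc]
  simp only [hr]
  have h₅ : ∀ a n l, L ≤ a ∨ L ≤ n ∨ L ≤ l → mul F (a + n) (mul F l u v) w = 0 := by
    intro a n l h
    rcases h with h | h | h
    · exact h₄ _ (by omega) l
    · exact h₄ _ (by omega) l
    · rw [h₃ l (by omega)]; simp
  rw [← sum_antidiagonal_of_support (fun l a => ∑ n ∈ Finset.range L,
    (dpow x l * dpow x a * dpow y n) • mul F (a + n) (mul F l u v) w) L K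
    (fun l a h => Finset.sum_eq_zero fun n _ => by rw [h₅ a n l (by tauto), smul_zero]) (by omega)]
  refine Finset.sum_congr rfl fun m _ => ?_
  simp only [Finset.smul_sum]
  rw [Finset.sum_comm, sum_range_eq_of_le (N := L) (M := K)]
  · refine Finset.sum_congr rfl fun n _ => ?_
    rw [Finset.Nat.sum_antidiagonal_eq_sum_range_succ_mk]
    refine Finset.sum_congr rfl fun l hl => ?_
    have hlm : l ≤ m := by simpa [Nat.lt_succ_iff] using hl
    obtain ⟨a, rfl⟩ := Nat.exists_eq_add_of_le hlm
    simp only [smul_smul, Nat.add_sub_cancel_left]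
    rw [show l + a + n - l = a + n by omega, dpow_mul]
    congr 1
    ring
  · intro n hn
    refine Finset.sum_eq_zero fun l hl => ?_
    have hlm : l ≤ m := by simpa [Nat.lt_succ_iff] using hl
    obtain ⟨a, rfl⟩ := Nat.exists_eq_add_of_le hlm
    rw [show l + a + n - l = a + n by omega, h₅ a n l (by tauto)]
    simp
  · omega

end Identities

/-! ### The signed transposition and its fixed space. -/

/-- The sign `(-1) ^ (i * j)`. -/
def sgn (i j : ZMod 2) : ℤ := (-1) ^ (i.val * j.val)

theorem sgn_mul_self (i j : ZMod 2) : sgn i j * sgn i j = 1 := by revert i j; decide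

theorem sgn_comm (i j : ZMod 2) : sgn i j = sgn j i := by revert i j; decide

/-- Transposing both factors carries the left scalar to the right one. The binomials agree
literally, and a check of parities shows that the supercommutator sign is absorbed by the signs of
the transposition. -/
theorem sgn_coeffRight_swap (n : ℕ) (i₁ i₂ j₁ j₂ : ZMod 2) (m₁ m₂ n₁ n₂ : ℕ) :
    sgn i₁ i₂ * sgn j₁ j₂ * coeffRight n ((i₂, i₁), (m₂, m₁)) ((j₂, j₁), (n₂, n₁)) =
      sgn i₁ j₂ * coeffLeft n ((i₁, i₂), (m₁, m₂)) ((j₁, j₂), (n₁, n₂)) := by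
  simp only [coeffRight, coeffLeft, add_comm m₂ m₁]
  by_cases h : i₂ = j₁ ∧ n ≤ m₁ + m₂ + n₁ + del0 i₂
  · rw [if_pos h, if_pos h]
    obtain ⟨rfl, -⟩ := h
    have key : sgn i₁ i₂ * sgn i₂ j₂ * (-(-1) ^ ((i₂ + i₁).val * (j₂ + i₂).val) *
        ((del1 i₂ : ℤ) - ((n₁ : ℤ) + 1) * del0 i₂)) =
        sgn i₁ j₂ * ((n₁ : ℤ) * del0 i₂ + 1) := by
      have h0 : ∀ i j : ZMod 2, sgn i 0 * sgn 0 j * (-1) ^ ((0 + i).val * (j + 0).val) =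
        sgn i j := by decide
      have h1 : ∀ i j : ZMod 2, sgn i 1 * sgn 1 j * -(-1) ^ ((1 + i).val * (j + 1).val) =
        sgn i j := by decide
      have h01 : i₂ = 0 ∨ i₂ = 1 := by generalize i₂ = i; revert i; decide
      rcases h01 with rfl | rfl
      · simp only [del0, del1, zero_ne_one, if_true, if_false]
        linear_combination ((n₁ : ℤ) + 1) * h0 i₁ j₂
      · simp only [del0, del1, one_ne_zero, if_true, if_false]
        linear_combination h1 i₁ j₂
    linear_combination (Ring.choose (-(n₁ : ℤ) - 1 - del0 i₂) m₂ *
      (((m₁ + m₂ + n₁ + del0 i₂ - n).choose m₁ : ℕ) : ℤ)) * key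
  · rw [if_neg h, if_neg h, mul_zero, mul_zero]

theorem sgn_coeffLeft_swap (n : ℕ) (i₁ i₂ j₁ j₂ : ZMod 2) (m₁ m₂ n₁ n₂ : ℕ) :
    sgn i₁ i₂ * sgn j₁ j₂ * coeffLeft n ((i₂, i₁), (m₂, m₁)) ((j₂, j₁), (n₂, n₁)) =
      sgn j₁ i₂ * coeffRight n ((i₁, i₂), (m₁, m₂)) ((j₁, j₂), (n₁, n₂)) := by
  have h := sgn_coeffRight_swap n i₂ i₁ j₂ j₁ m₂ m₁ n₂ n₁
  rw [sgn_comm i₂ i₁, sgn_comm j₂ j₁, sgn_comm i₂ j₁] at h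
  have h1 := sgn_mul_self i₁ i₂
  have h2 := sgn_mul_self j₁ j₂
  have h3 := sgn_mul_self j₁ i₂
  linear_combination (-sgn j₁ i₂ * sgn i₁ i₂ * sgn j₁ j₂) * h +
    (-sgn i₁ i₂ * sgn j₁ j₂ * coeffLeft n ((i₂, i₁), (m₂, m₁)) ((j₂, j₁), (n₂, n₁))) * h3 +
    (sgn j₁ i₂ * coeffRight n ((i₁, i₂), (m₁, m₂)) ((j₁, j₂), (n₁, n₂))) *
      (sgn j₁ j₂ * sgn j₁ j₂) * h1 +
    (sgn j₁ i₂ * coeffRight n ((i₁, i₂), (m₁, m₂)) ((j₁, j₂), (n₁, n₂))) * h2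

section Matrices

variable {F : Type*} [Field F] {k₁ k₂ : ℕ}

/-- The signed transposition `u_{[i,j]}(m, n) ↦ (-1) ^ (i j) uᵀ_{[j,i]}(n, m)`. -/
def twist (F : Type*) [Field F] (k₁ k₂ : ℕ) :
    Ambient (Mat F k₁ k₂) →ₗ[F] Ambient (Mat F k₁ k₂) :=
  Finsupp.lsum F fun a => ((sgn a.1.1 a.1.2 : ℤ) : F) •
    (Finsupp.lsingle ((a.1.2, a.1.1), (a.2.2, a.2.1))).comp
      (Matrix.transposeLinearEquiv _ _ F F).toLinearMap

theorem twist_elt (i j : ZMod 2) (m n : ℕ) (u : Mat F k₁ k₂) :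
    twist F k₁ k₂ (elt i j m n u) = ((sgn i j : ℤ) : F) • elt j i n m u.transpose := by
  simp [twist, elt]

theorem twist_twist (x : Ambient (Mat F k₁ k₂)) : twist F k₁ k₂ (twist F k₁ k₂ x) = x := by
  induction x using elt_induction with
  | h0 => simp
  | hadd u v hu hv => simp [hu, hv]
  | h i j m n a =>
    rw [twist_elt, map_smul, twist_elt, smul_smul, ← Int.cast_mul, sgn_comm j i, sgn_mul_self]
    simp

/-- Transposition reverses matrix products, but it also interchanges the two terms of the product
formula, so an automorphism results rather than an anti-automorphism. -/
theorem twist_mul (n : ℕ) (x y : Ambient (Mat F k₁ k₂)) :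
    mul F n (twist F k₁ k₂ x) (twist F k₁ k₂ y) = twist F k₁ k₂ (mul F n x y) := by
  induction x using elt_induction with
  | h0 => simp
  | hadd u v hu hv => simp [hu, hv]
  | h i₁ i₂ m₁ m₂ u =>
    induction y using elt_induction with
    | h0 => simp
    | hadd u v hu hv => simp [hu, hv]
    | h j₁ j₂ n₁ n₂ v =>
      rw [twist_elt, twist_elt, map_smul, map_smul, LinearMap.smul_apply, mul_elt, mul_elt,
        map_add, map_smul, map_smul, twist_elt, twist_elt]
      simp only [smul_add, smul_smul, ← Int.cast_mul, Matrix.transpose_mul, ← mul_assoc]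
      rw [add_comm]
      have h1 := sgn_coeffRight_swap n i₁ i₂ j₁ j₂ m₁ m₂ n₁ n₂
      have h2 := sgn_coeffLeft_swap n i₁ i₂ j₁ j₂ m₁ m₂ n₁ n₂
      rw [mul_comm (sgn j₁ j₂), h1, h2, add_comm m₂ m₁, mul_comm (coeffLeft _ _ _),
        mul_comm (coeffRight _ _ _)]

/-- The element `(E_{p,q})_{[i,j]}(m, n)` with the block indices `i`, `j` of `p`, `q`. -/
def unit (F : Type*) [Field F] {k₁ k₂ : ℕ} (p q : Fin k₁ ⊕ Fin k₂) (m n : ℕ) :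
    Ambient (Mat F k₁ k₂) :=
  E F (blk p) (blk q) p q m n

theorem twist_unit (p q : Fin k₁ ⊕ Fin k₂) (m n : ℕ) :
    twist F k₁ k₂ (unit F p q m n) = ((sgn (blk p) (blk q) : ℤ) : F) • unit F q p n m := by
  rw [unit, E, twist_elt, Matrix.transpose_single]
  rfl

theorem mul_unit (n : ℕ) (p q r s : Fin k₁ ⊕ Fin k₂) (m₁ m₂ n₁ n₂ : ℕ) :
    mul F n (unit F p q m₁ m₂) (unit F r s n₁ n₂) =
      (if q = r then ((coeffLeft n ((blk p, blk q), (m₁, m₂)) ((blk r, blk s), (n₁, n₂)) : ℤ) : F)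
        else 0) • unit F p s (m₁ + m₂ + n₁ + del0 (blk q) - n) n₂ +
      (if p = s then ((coeffRight n ((blk p, blk q), (m₁, m₂)) ((blk r, blk s), (n₁, n₂)) : ℤ) : F)
        else 0) • unit F r q n₁ (m₁ + m₂ + n₂ + del0 (blk p) - n) := by
  rw [unit, unit, E, E, mul_elt]
  congr 1
  · by_cases h : q = r
    · subst h; simp [unit, E]
    · simp [h, Matrix.single_mul_single_of_ne _ _ _ _ h, elt]
  · by_cases h : p = s
    · subst h; simp [unit, E]
    · simp [h, Matrix.single_mul_single_of_ne _ _ _ _ (Ne.symm h), elt]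

theorem D_unit (p q : Fin k₁ ⊕ Fin k₂) (m n : ℕ) :
    D F (unit F p q m n) =
      ((m : F) + 1) • unit F p q (m + 1) n + ((n : F) + 1) • unit F p q m (n + 1) :=
  D_elt _ _ _ _ _

theorem unit_mem_parityPart (p q : Fin k₁ ⊕ Fin k₂) (m n : ℕ) :
    unit F p q m n ∈ parityPart F (Mat F k₁ k₂) (blk p + blk q) :=
  elt_mem_parityPart _ _ _ _ _

theorem blockAlg_eq_span : blockAlg F k₁ k₂ 0 =
    Submodule.span F {x | ∃ p q m n, x = unit F (k₁ := k₁) (k₂ := k₂) p q m n} := by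
  apply le_antisymm
  · simp only [blockAlg, blockPart, if_true, one_ne_zero, if_false, sup_le_iff, Submodule.span_le]
    constructor
    · rintro x (⟨p, q, m, n, rfl⟩ | ⟨p, q, m, n, rfl⟩)
      · exact Submodule.subset_span ⟨.inl p, .inl q, m, n, rfl⟩
      · exact Submodule.subset_span ⟨.inr p, .inr q, m, n, rfl⟩
    · rintro x (⟨p, q, m, n, rfl⟩ | ⟨p, q, m, n, rfl⟩)
      · exact Submodule.subset_span ⟨.inl p, .inr q, m, n, rfl⟩
      · exact Submodule.subset_span ⟨.inr q, .inl p, m, n, rfl⟩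
  · rw [Submodule.span_le]
    rintro x ⟨p | p, q | q, m, n, rfl⟩
    · refine Submodule.mem_sup_left ?_
      simp only [blockPart, if_true]
      exact Submodule.subset_span (Or.inl ⟨p, q, m, n, rfl⟩)
    · refine Submodule.mem_sup_right ?_
      simp only [blockPart, one_ne_zero, if_false]
      exact Submodule.subset_span (Or.inl ⟨p, q, m, n, rfl⟩)
    · refine Submodule.mem_sup_right ?_
      simp only [blockPart, one_ne_zero, if_false]
      exact Submodule.subset_span (Or.inr ⟨q, p, m, n, rfl⟩)
    · refine Submodule.mem_sup_left ?_
      simp only [blockPart, if_true]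
      exact Submodule.subset_span (Or.inr ⟨p, q, m, n, rfl⟩)

theorem unit_mem_blockAlg (p q : Fin k₁ ⊕ Fin k₂) (m n : ℕ) :
    unit F p q m n ∈ blockAlg F k₁ k₂ 0 := by
  rw [blockAlg_eq_span]
  exact Submodule.subset_span ⟨p, q, m, n, rfl⟩

theorem blockAlg_induction {P : Ambient (Mat F k₁ k₂) → Prop} (h0 : P 0)
    (hadd : ∀ u v, P u → P v → P (u + v)) (hsmul : ∀ (c : F) u, P u → P (c • u))
    (h : ∀ p q m n, P (unit F p q m n)) {x : Ambient (Mat F k₁ k₂)}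
    (hx : x ∈ blockAlg F k₁ k₂ 0) : P x := by
  rw [blockAlg_eq_span] at hx
  induction hx using Submodule.span_induction with
  | mem x hx => obtain ⟨p, q, m, n, rfl⟩ := hx; exact h p q m n
  | zero => exact h0
  | add x y _ _ hx hy => exact hadd _ _ hx hy
  | smul a x _ hx => exact hsmul _ _ hx

theorem mul_mem_blockAlg (n : ℕ) {x y : Ambient (Mat F k₁ k₂)} (hx : x ∈ blockAlg F k₁ k₂ 0)
    (hy : y ∈ blockAlg F k₁ k₂ 0) : mul F n x y ∈ blockAlg F k₁ k₂ 0 := by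
  refine blockAlg_induction (P := fun x => mul F n x y ∈ blockAlg F k₁ k₂ 0) (by simp)
    (fun u v hu hv => by rw [map_add]; exact add_mem hu hv)
    (fun c u hu => by rw [map_smul]; exact Submodule.smul_mem _ _ hu) (fun p q m₁ m₂ => ?_) hx
  refine blockAlg_induction (P := fun y => mul F n (unit F p q m₁ m₂) y ∈ blockAlg F k₁ k₂ 0)
    (by simp) (fun u v hu hv => by rw [map_add]; exact add_mem hu hv)
    (fun c u hu => by rw [map_smul]; exact Submodule.smul_mem _ _ hu) (fun r s n₁ n₂ => ?_) hy
  rw [mul_unit]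
  exact add_mem (Submodule.smul_mem _ _ (unit_mem_blockAlg _ _ _ _))
    (Submodule.smul_mem _ _ (unit_mem_blockAlg _ _ _ _))

theorem D_mem_blockAlg {x : Ambient (Mat F k₁ k₂)} (hx : x ∈ blockAlg F k₁ k₂ 0) :
    D F x ∈ blockAlg F k₁ k₂ 0 := by
  refine blockAlg_induction (P := fun x => D F x ∈ blockAlg F k₁ k₂ 0) (by simp)
    (fun u v hu hv => by rw [map_add]; exact add_mem hu hv)
    (fun c u hu => by rw [map_smul]; exact Submodule.smul_mem _ _ hu) (fun p q m₁ m₂ => ?_) hx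
  rw [D_unit]
  exact add_mem (Submodule.smul_mem _ _ (unit_mem_blockAlg _ _ _ _))
    (Submodule.smul_mem _ _ (unit_mem_blockAlg _ _ _ _))

theorem twist_D (x : Ambient (Mat F k₁ k₂)) : D F (twist F k₁ k₂ x) = twist F k₁ k₂ (D F x) := by
  induction x using elt_induction with
  | h0 => simp
  | hadd u v hu hv => simp [hu, hv]
  | h i j m n a =>
    simp only [twist_elt, D_elt, map_smul, map_add]
    module

theorem blockAlg_le_fullSpace : blockAlg F k₁ k₂ 0 ≤ fullSpace (matGrading F k₁ k₂) := by
  rw [blockAlg_eq_span, Submodule.span_le]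
  rintro x ⟨p, q, m, n, rfl⟩
  refine Submodule.subset_span ⟨blk p, blk q, m, n, _, fun r s h => ?_, rfl⟩
  refine Matrix.single_apply_of_ne _ _ _ _ _ ?_
  rintro ⟨rfl, rfl⟩
  exact h rfl

/-- The twist-invariant element `(E_{p,q})(m, n) ± (E_{q,p})(n, m)`. -/
def symUnit (F : Type*) [Field F] {k₁ k₂ : ℕ} (p q : Fin k₁ ⊕ Fin k₂) (m n : ℕ) :
    Ambient (Mat F k₁ k₂) :=
  unit F p q m n + ((sgn (blk p) (blk q) : ℤ) : F) • unit F q p n m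

theorem symUnit_eq (p q : Fin k₁ ⊕ Fin k₂) (m n : ℕ) :
    symUnit F p q m n = unit F p q m n + twist F k₁ k₂ (unit F p q m n) := by
  rw [twist_unit]; rfl

theorem symUnit_swap (p q : Fin k₁ ⊕ Fin k₂) (m n : ℕ) :
    symUnit F q p n m = ((sgn (blk p) (blk q) : ℤ) : F) • symUnit F p q m n := by
  rw [symUnit, symUnit, smul_add, smul_smul, ← Int.cast_mul, sgn_mul_self, sgn_comm (blk q),
    add_comm]
  simp

theorem twist_symUnit (p q : Fin k₁ ⊕ Fin k₂) (m n : ℕ) :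
    twist F k₁ k₂ (symUnit F p q m n) = symUnit F p q m n := by
  rw [symUnit_eq, map_add, twist_twist, add_comm]

theorem symUnit_mem_blockAlg (p q : Fin k₁ ⊕ Fin k₂) (m n : ℕ) :
    symUnit F p q m n ∈ blockAlg F k₁ k₂ 0 :=
  add_mem (unit_mem_blockAlg _ _ _ _) (Submodule.smul_mem _ _ (unit_mem_blockAlg _ _ _ _))

/-- One family of spanning elements replaces the three block types; the sign `sgn` supplies the
minus in the second diagonal block, and `symUnit_swap` handles the reversed off-diagonal order. -/
theorem starPart_eq_span (i : ZMod 2) : starPart F k₁ k₂ i =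
    Submodule.span F {x | ∃ p q m n, blk p + blk q = i ∧
      x = symUnit F (k₁ := k₁) (k₂ := k₂) p q m n} := by
  have h01 : i = 0 ∨ i = 1 := by revert i; decide
  have s00 : ((sgn 0 0 : ℤ) : F) = 1 := by simp [sgn]
  have s01 : ((sgn 0 1 : ℤ) : F) = 1 := by simp [sgn]
  have s10 : ((sgn 1 0 : ℤ) : F) = 1 := by simp [sgn]
  have s11 : ((sgn 1 1 : ℤ) : F) = -1 := by
    rw [show sgn 1 1 = -1 from by decide]; simp
  have a00 : (0 : ZMod 2) + 0 = 0 := by decide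
  have a01 : (0 : ZMod 2) + 1 ≠ 0 := by decide
  have a10 : (1 : ZMod 2) + 0 ≠ 0 := by decide
  have a11 : (1 : ZMod 2) + 1 = 0 := by decide
  rcases h01 with rfl | rfl
  · simp only [starPart, if_true]
    congr 1
    ext x
    constructor
    · rintro (⟨p, q, m, n, rfl⟩ | ⟨p, q, m, n, rfl⟩)
      · exact ⟨.inl p, .inl q, m, n, a00, by simp [symUnit, unit, blk, s00]⟩
      · exact ⟨.inr p, .inr q, m, n, a11, by simp [symUnit, unit, blk, s11, sub_eq_add_neg]⟩
    · rintro ⟨p | p, q | q, m, n, h, rfl⟩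
      · exact Or.inl ⟨p, q, m, n, by simp [symUnit, unit, blk, s00]⟩
      · exact absurd h a01
      · exact absurd h a10
      · exact Or.inr ⟨p, q, m, n, by simp [symUnit, unit, blk, s11, sub_eq_add_neg]⟩
  · simp only [starPart, one_ne_zero, if_false]
    apply le_antisymm
    · refine Submodule.span_mono ?_
      rintro x ⟨p, q, m, n, rfl⟩
      exact ⟨.inl p, .inr q, m, n, zero_add _, by simp [symUnit, unit, blk, s01]⟩
    · rw [Submodule.span_le]
      rintro x ⟨p | p, q | q, m, n, h, rfl⟩
      · exact absurd h (by simp [blk])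
      · exact Submodule.subset_span ⟨p, q, m, n, by simp [symUnit, unit, blk, s01]⟩
      · rw [symUnit_swap]
        exact Submodule.smul_mem _ _ (Submodule.subset_span
          ⟨q, p, n, m, by simp [symUnit, unit, blk, s01]⟩)
      · exact absurd h (by simp only [blk, Sum.elim_inr]; decide)

theorem symUnit_mem_starPart (p q : Fin k₁ ⊕ Fin k₂) (m n : ℕ) :
    symUnit F p q m n ∈ starPart F k₁ k₂ (blk p + blk q) := by
  rw [starPart_eq_span]
  exact Submodule.subset_span ⟨p, q, m, n, rfl, rfl⟩

theorem starPart_le_starAlg (i : ZMod 2) : starPart F k₁ k₂ i ≤ starAlg F k₁ k₂ := by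
  have h01 : i = 0 ∨ i = 1 := by revert i; decide
  rcases h01 with rfl | rfl
  · exact le_sup_left
  · exact le_sup_right

theorem symUnit_mem_starAlg (p q : Fin k₁ ⊕ Fin k₂) (m n : ℕ) :
    symUnit F p q m n ∈ starAlg F k₁ k₂ :=
  starPart_le_starAlg _ (symUnit_mem_starPart p q m n)

theorem starAlg_eq_span : starAlg F k₁ k₂ =
    Submodule.span F {x | ∃ p q m n, x = symUnit F (k₁ := k₁) (k₂ := k₂) p q m n} := by
  apply le_antisymm
  · rw [starAlg, starPart_eq_span, starPart_eq_span]
    refine sup_le (Submodule.span_mono ?_) (Submodule.span_mono ?_) <;>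
    · rintro x ⟨p, q, m, n, -, rfl⟩
      exact ⟨p, q, m, n, rfl⟩
  · rw [Submodule.span_le]
    rintro x ⟨p, q, m, n, rfl⟩
    exact symUnit_mem_starAlg p q m n

theorem starPart_le_parityPart (i : ZMod 2) :
    starPart F k₁ k₂ i ≤ parityPart F (Mat F k₁ k₂) i := by
  rw [starPart_eq_span, Submodule.span_le]
  rintro x ⟨p, q, m, n, rfl, rfl⟩
  refine add_mem (unit_mem_parityPart _ _ _ _) (Submodule.smul_mem _ _ ?_)
  rw [add_comm]
  exact unit_mem_parityPart _ _ _ _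

theorem starAlg_le_blockAlg : starAlg F k₁ k₂ ≤ blockAlg F k₁ k₂ 0 := by
  rw [starAlg_eq_span, Submodule.span_le]
  rintro x ⟨p, q, m, n, rfl⟩
  exact symUnit_mem_blockAlg p q m n

theorem twist_eq_self {x : Ambient (Mat F k₁ k₂)} (hx : x ∈ starAlg F k₁ k₂) :
    twist F k₁ k₂ x = x := by
  rw [starAlg_eq_span] at hx
  induction hx using Submodule.span_induction with
  | mem x hx => obtain ⟨p, q, m, n, rfl⟩ := hx; exact twist_symUnit p q m n
  | zero => simp
  | add x y _ _ hx hy => rw [map_add, hx, hy]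
  | smul a x _ hx => rw [map_smul, hx]

variable [CharZero F]

/-- Averaging: an invariant `x` is half of `x + twist x`, and that sum is a combination of symmetric
units. Stability of R* now follows from the compatibility of `twist` with the operations. -/
theorem mem_starAlg {x : Ambient (Mat F k₁ k₂)} (hx : x ∈ blockAlg F k₁ k₂ 0)
    (ht : twist F k₁ k₂ x = x) : x ∈ starAlg F k₁ k₂ := by
  have h : ∀ x ∈ blockAlg F k₁ k₂ 0, x + twist F k₁ k₂ x ∈ starAlg F k₁ k₂ := by
    intro x hx
    refine blockAlg_induction (P := fun x => x + twist F k₁ k₂ x ∈ starAlg F k₁ k₂) (by simp)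
      (fun u v hu hv => ?_) (fun c u hu => ?_) (fun p q m n => ?_) hx
    · rw [map_add, add_add_add_comm]; exact add_mem hu hv
    · rw [map_smul, ← smul_add]; exact Submodule.smul_mem _ _ hu
    · rw [← symUnit_eq]; exact symUnit_mem_starAlg p q m n
  have h2 := Submodule.smul_mem _ (2 : F)⁻¹ (h x hx)
  rwa [ht, ← two_smul F x, smul_smul, inv_mul_cancel₀ two_ne_zero, one_smul] at h2

theorem mul_mem_starAlg (n : ℕ) {x y : Ambient (Mat F k₁ k₂)} (hx : x ∈ starAlg F k₁ k₂)
    (hy : y ∈ starAlg F k₁ k₂) : mul F n x y ∈ starAlg F k₁ k₂ := by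
  refine mem_starAlg (mul_mem_blockAlg n (starAlg_le_blockAlg hx) (starAlg_le_blockAlg hy)) ?_
  rw [← twist_mul, twist_eq_self hx, twist_eq_self hy]

theorem D_mem_starAlg {x : Ambient (Mat F k₁ k₂)} (hx : x ∈ starAlg F k₁ k₂) :
    D F x ∈ starAlg F k₁ k₂ := by
  refine mem_starAlg (D_mem_blockAlg (starAlg_le_blockAlg hx)) ?_
  rw [← twist_D, twist_eq_self hx]

omit [CharZero F] in
theorem mem_starPart {i : ZMod 2} {x : Ambient (Mat F k₁ k₂)} (hx : x ∈ starAlg F k₁ k₂)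
    (hi : x ∈ parityPart F (Mat F k₁ k₂) i) : x ∈ starPart F k₁ k₂ i := by
  have h01 : i = 0 ∨ i = 1 := by clear hi; revert i; decide
  obtain ⟨y, hy, z, hz, rfl⟩ := Submodule.mem_sup.1 hx
  rcases h01 with rfl | rfl
  · have h0 : z = 0 := Submodule.disjoint_def.1 disjoint_parityPart z
      (by simpa using sub_mem hi (starPart_le_parityPart 0 hy)) (starPart_le_parityPart 1 hz)
    rwa [h0, add_zero]
  · have h0 : y = 0 := Submodule.disjoint_def.1 disjoint_parityPart y
      (starPart_le_parityPart 0 hy) (by simpa using sub_mem hi (starPart_le_parityPart 1 hz))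
    rwa [h0, zero_add]

/-! ### The conformal superalgebra structure on the fixed space. -/

variable (F k₁ k₂) in
/-- The operator `∂` on `R*_{[k₁,k₂]}`. -/
def starD : starAlg F k₁ k₂ →ₗ[F] starAlg F k₁ k₂ := (D F).restrict fun _ hx => D_mem_starAlg hx

theorem coe_starD_pow (l : ℕ) (x : starAlg F k₁ k₂) :
    ((starD F k₁ k₂ ^ l) x : Ambient (Mat F k₁ k₂)) = (D F ^ l) x := by
  induction l with
  | zero => simp
  | succ l ih => rw [pow_succ', pow_succ', Module.End.mul_apply, Module.End.mul_apply, ← ih]; rfl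

variable (F k₁ k₂) in
/-- The `n`-th product on `R*_{[k₁,k₂]}`. -/
def starMul (n : ℕ) : starAlg F k₁ k₂ →ₗ[F] starAlg F k₁ k₂ →ₗ[F] starAlg F k₁ k₂ :=
  LinearMap.mk₂ F (fun x y => ⟨mul F n x y, mul_mem_starAlg n x.2 y.2⟩)
    (fun _ _ _ => Subtype.ext (by simp)) (fun _ _ _ => Subtype.ext (by simp))
    (fun _ _ _ => Subtype.ext (by simp)) (fun _ _ _ => Subtype.ext (by simp))

theorem coe_starMul (n : ℕ) (x y : starAlg F k₁ k₂) :
    (starMul F k₁ k₂ n x y : Ambient (Mat F k₁ k₂)) = mul F n x y := rfl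

variable (F k₁ k₂) in
/-- The conformal superalgebra on `R*_{[k₁,k₂]}`. -/
def starConformal : ConformalSuperalgebra F (starAlg F k₁ k₂) where
  parity i := (starPart F k₁ k₂ i).comap (starAlg F k₁ k₂).subtype
  parity_isCompl := by
    constructor
    · refine Submodule.disjoint_def.2 fun x h0 h1 => Subtype.ext ?_
      exact Submodule.disjoint_def.1 disjoint_parityPart x.1 (starPart_le_parityPart 0 h0)
        (starPart_le_parityPart 1 h1)
    · refine codisjoint_iff.2 (eq_top_iff.2 fun x _ => ?_)
      obtain ⟨y, hy, z, hz, h⟩ := Submodule.mem_sup.1 x.2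
      exact Submodule.mem_sup.2 ⟨⟨y, starPart_le_starAlg 0 hy⟩, hy,
        ⟨z, starPart_le_starAlg 1 hz⟩, hz, Subtype.ext h⟩
  D := starD F k₁ k₂
  D_mem i u hu := mem_starPart (D_mem_starAlg u.2) (D_mem_parityPart (starPart_le_parityPart i hu))
  mul := starMul F k₁ k₂
  mul_mem i j u v hu hv n := mem_starPart (mul_mem_starAlg n u.2 v.2)
    (mul_mem_parityPart (starPart_le_parityPart i hu) (starPart_le_parityPart j hv) n)
  truncation u v := (exists_mul_eq_zero (F := F) u.1 v.1).imp fun N h n hn => Subtype.ext (h n hn)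
  mul_D_zero u v := Subtype.ext (mul_D (F := F) u.1 v.1).1
  mul_D_succ n u v := Subtype.ext ((mul_D (F := F) u.1 v.1).2 n)
  skew i j u v hu hv n N hN := by
    refine Subtype.ext ?_
    simp only [Submodule.coe_smul, Submodule.coe_sum, coe_starD_pow, coe_starMul]
    exact mul_skew (starPart_le_parityPart i hu) (starPart_le_parityPart j hv) n N
      (fun m hm => congrArg Subtype.val (hN m hm))
  jacobi i j u v hu hv m n w := by
    refine Subtype.ext ?_
    simp only [Submodule.coe_smul, Submodule.coe_sum, coe_starMul, Submodule.coe_sub]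
    exact mul_jacobi (starPart_le_parityPart i hu) (starPart_le_parityPart j hv) m n w.1

theorem map_parity_starConformal (i : ZMod 2) :
    ((starConformal F k₁ k₂).parity i).map (starAlg F k₁ k₂).subtype = starPart F k₁ k₂ i := by
  refine (Submodule.map_comap_subtype _ _).trans (inf_eq_right.2 (starPart_le_starAlg i))

end Matrices

end DoubleAffine

/-! ### Nested products are closed under all products. -/

namespace ConformalSuperalgebra

variable {F R : Type*} [Field F] [AddCommGroup R] [Module F R]

/-- The top term `l = m` of the Jacobi identity expresses the action of `u_m v` through actions of
`u` and `v` and of the products `u_l v` with `l < m`. Parity is carried along because Jacobi needs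
homogeneous elements. -/
theorem IsNested.mul_mem_span {C : ConformalSuperalgebra F R} {S : Set R}
    (hS : ∀ u ∈ S, ∃ i, u ∈ C.parity i) {x : R} (hx : C.IsNested S x) :
    (∃ i, x ∈ C.parity i) ∧ ∀ n, ∀ w ∈ Submodule.span F {x : R | C.IsNested S x},
      C.mul n x w ∈ Submodule.span F {x : R | C.IsNested S x} := by
  have hbase : ∀ u ∈ S, ∀ n, ∀ w ∈ Submodule.span F {x : R | C.IsNested S x},
      C.mul n u w ∈ Submodule.span F {x : R | C.IsNested S x} := by
    intro u hu n w hw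
    induction hw using Submodule.span_induction with
    | mem w hw => exact Submodule.subset_span (IsNested.step u hu n w hw)
    | zero => rw [map_zero]; exact zero_mem _
    | add a b _ _ ha hb => rw [map_add]; exact add_mem ha hb
    | smul c a _ ha => rw [map_smul]; exact Submodule.smul_mem _ _ ha
  induction hx with
  | base v hv => exact ⟨hS v hv, hbase v hv⟩
  | step u hu m v hv ih =>
    obtain ⟨i, hi⟩ := hS u hu
    obtain ⟨⟨j, hj⟩, ihv⟩ := ih
    refine ⟨⟨i + j, C.mul_mem i j u v hi hj m⟩, ?_⟩
    induction m using Nat.strong_induction_on with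
    | _ m ihm =>
      intro n w hw
      have h := C.jacobi i j u v hi hj m n w
      rw [Finset.sum_range_succ] at h
      simp only [Nat.choose_self, Nat.cast_one, one_smul, Nat.add_sub_cancel_left] at h
      rw [← sub_eq_iff_eq_add'] at h
      rw [← h]
      refine sub_mem (sub_mem (hbase u hu m _ (ihv n w hw))
        (Submodule.smul_mem _ _ (ihv n _ (hbase u hu m w hw)))) ?_
      exact Submodule.sum_mem _ fun l hl => Submodule.smul_mem _ _
        (ihm l (Finset.mem_range.1 hl) _ w hw)

/-- The span of the nested products of homogeneous elements is closed under all products. -/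
theorem mul_mem_span_isNested {C : ConformalSuperalgebra F R} {S : Set R}
    (hS : ∀ u ∈ S, ∃ i, u ∈ C.parity i) (n : ℕ) {x y : R}
    (hx : x ∈ Submodule.span F {x : R | C.IsNested S x})
    (hy : y ∈ Submodule.span F {x : R | C.IsNested S x}) :
    C.mul n x y ∈ Submodule.span F {x : R | C.IsNested S x} := by
  induction hx using Submodule.span_induction with
  | mem x hx => exact (hx.mul_mem_span hS).2 n y hy
  | zero => rw [map_zero]; exact zero_mem _
  | add a b _ _ ha hb => rw [map_add]; exact add_mem ha hb
  | smul c a _ ha => rw [map_smul]; exact Submodule.smul_mem _ _ ha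

end ConformalSuperalgebra

/-! ### The subspace of weight 3/2. -/

namespace DoubleAffine

variable {F : Type*} [Field F] {k₁ k₂ : ℕ}

theorem eq_of_weight_eq (i j : ZMod 2) (m n : ℕ)
    (h : (m : ℚ) + n + del0 i + del0 j + ((del1 i : ℚ) + del1 j) / 2 = 3 / 2) :
    ((i, j), (m, n)) = (((0 : ZMod 2), (1 : ZMod 2)), (0, 0)) ∨
      ((i, j), (m, n)) = (((1 : ZMod 2), (0 : ZMod 2)), (0, 0)) := by
  have h' : 2 * m + 2 * n + 2 * del0 i + 2 * del0 j + del1 i + del1 j = 3 := by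
    have : (2 * m + 2 * n + 2 * del0 i + 2 * del0 j + del1 i + del1 j : ℚ) = 3 := by linarith
    exact_mod_cast this
  have hi : i = 0 ∨ i = 1 := by clear h h'; revert i; decide
  have hj : j = 0 ∨ j = 1 := by clear h h'; revert j; decide
  rcases hi with rfl | rfl <;> rcases hj with rfl | rfl <;> simp [del0, del1] at h' ⊢ <;> omega

/-- The projection to the components of weight `3 / 2`. -/
def weightProj (F : Type*) [Field F] (k₁ k₂ : ℕ) :
    Ambient (Mat F k₁ k₂) →ₗ[F] Ambient (Mat F k₁ k₂) :=
  (Finsupp.lsingle ((0, 1), (0, 0))).comp (Finsupp.lapply ((0, 1), (0, 0))) +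
    (Finsupp.lsingle ((1, 0), (0, 0))).comp (Finsupp.lapply ((1, 0), (0, 0)))

theorem weightProj_eq_self {x : Ambient (Mat F k₁ k₂)}
    (hx : x ∈ weightSpace (matGrading F k₁ k₂) (3 / 2)) : weightProj F k₁ k₂ x = x := by
  refine Submodule.span_induction (p := fun x _ => weightProj F k₁ k₂ x = x) ?_ (by simp)
    (fun x y _ _ hx hy => by rw [map_add, hx, hy]) (fun c x _ hx => by rw [map_smul, hx]) hx
  rintro x ⟨i, j, m, n, u, -, hw, rfl⟩
  rcases eq_of_weight_eq i j m n hw with h | h <;>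
  · simp only [Prod.mk.injEq] at h
    obtain ⟨⟨rfl, rfl⟩, rfl, rfl⟩ := h
    simp [weightProj, elt]

/-- An element of the intersection is fixed by `weightProj`. On the other hand `weightProj` maps
each spanning symmetric unit into the right-hand span. -/
theorem starAlg_inf_weightSpace : starAlg F k₁ k₂ ⊓ weightSpace (matGrading F k₁ k₂) (3 / 2) =
    Submodule.span F {x | ∃ (p : Fin k₁) (q : Fin k₂),
      x = symUnit F (Sum.inl p) (Sum.inr q) 0 0} := by
  apply le_antisymm
  · rintro x ⟨hx, hw⟩
    rw [← weightProj_eq_self hw]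
    clear hw
    rw [SetLike.mem_coe, starAlg_eq_span] at hx
    induction hx using Submodule.span_induction with
    | mem x hx =>
      have key : ∀ (p : Fin k₁) (q : Fin k₂) (m n : ℕ), weightProj F k₁ k₂
          (symUnit F (Sum.inl p) (Sum.inr q) m n) ∈ Submodule.span F {x | ∃ (p : Fin k₁)
            (q : Fin k₂), x = symUnit F (Sum.inl p) (Sum.inr q) 0 0} := by
        intro p q m n
        by_cases h : m = 0 ∧ n = 0
        · obtain ⟨rfl, rfl⟩ := h
          have : weightProj F k₁ k₂ (symUnit F (Sum.inl p) (Sum.inr q) 0 0) =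
              symUnit F (Sum.inl p) (Sum.inr q) 0 0 := by
            simp [weightProj, symUnit, unit, E, elt, blk]
          rw [this]
          exact Submodule.subset_span ⟨p, q, rfl⟩
        · have : weightProj F k₁ k₂ (symUnit F (Sum.inl p) (Sum.inr q) m n) = 0 := by
            simp [weightProj, symUnit, unit, E, elt, blk, h,
              show ¬ (n = 0 ∧ m = 0) by tauto]
          rw [this]
          exact zero_mem _
      obtain ⟨p | p, q | q, m, n, rfl⟩ := hx
      · simp [weightProj, symUnit, unit, E, elt, blk]
      · exact key p q m n
      · rw [symUnit_swap, map_smul]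
        exact Submodule.smul_mem _ _ (key q p n m)
      · simp [weightProj, symUnit, unit, E, elt, blk]
    | zero => rw [map_zero]; exact zero_mem _
    | add a b _ _ ha hb => rw [map_add]; exact add_mem ha hb
    | smul c a _ ha => rw [map_smul]; exact Submodule.smul_mem _ _ ha
  · rw [Submodule.span_le]
    rintro x ⟨p, q, rfl⟩
    refine ⟨symUnit_mem_starAlg _ _ _ _, add_mem (Submodule.subset_span ?_)
      (Submodule.smul_mem _ _ (Submodule.subset_span ?_))⟩
    · refine ⟨0, 1, 0, 0, _, fun r s h => ?_, ?_, rfl⟩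
      · refine Matrix.single_apply_of_ne _ _ _ _ _ ?_
        rintro ⟨rfl, rfl⟩
        exact h rfl
      · norm_num [del0, del1]
    · refine ⟨1, 0, 0, 0, _, fun r s h => ?_, ?_, rfl⟩
      · refine Matrix.single_apply_of_ne _ _ _ _ _ ?_
        rintro ⟨rfl, rfl⟩
        exact h rfl
      · norm_num [del0, del1]

/-- The left factor is invariant, so the second half of the product is the twist of the first and
only one half has to be computed. -/
theorem mul_symUnit (n : ℕ) (p q r s : Fin k₁ ⊕ Fin k₂) (m₁ m₂ n₁ n₂ : ℕ) :
    mul F n (symUnit F p q m₁ m₂) (symUnit F r s n₁ n₂) =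
      mul F n (symUnit F p q m₁ m₂) (unit F r s n₁ n₂) +
        twist F k₁ k₂ (mul F n (symUnit F p q m₁ m₂) (unit F r s n₁ n₂)) := by
  rw [← twist_mul, twist_symUnit, ← map_add, ← symUnit_eq]

/-! ### Explicit products with quadratic and odd generators. -/

@[simp] theorem blk_inl (p : Fin k₁) : blk (Sum.inl p : Fin k₁ ⊕ Fin k₂) = 0 := rfl

@[simp] theorem blk_inr (p : Fin k₂) : blk (Sum.inr p : Fin k₁ ⊕ Fin k₂) = 1 := rfl

theorem sgn_zero_left (i : ZMod 2) : sgn 0 i = 1 := by revert i; decide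

theorem sgn_zero_right (i : ZMod 2) : sgn i 0 = 1 := by revert i; decide

theorem sgn_one_one : sgn 1 1 = -1 := by decide

theorem one_add_one_eq_zero_zmod : (1 : ZMod 2) + 1 = 0 := by decide

theorem val_one_zmod : ZMod.val (1 : ZMod 2) = 1 := rfl

theorem mul_symUnit_unit (n : ℕ) (p q r s : Fin k₁ ⊕ Fin k₂) (m₁ m₂ n₁ n₂ : ℕ) :
    mul F n (symUnit F p q m₁ m₂) (unit F r s n₁ n₂) =
      mul F n (unit F p q m₁ m₂) (unit F r s n₁ n₂) + ((sgn (blk p) (blk q) : ℤ) : F) •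
        mul F n (unit F q p m₂ m₁) (unit F r s n₁ n₂) := by
  rw [symUnit, map_add, map_smul, LinearMap.add_apply, LinearMap.smul_apply]

/-- The square `α_p²` of a bosonic generator, or `ψ_r ∂ψ_r` for a fermionic generator. -/
def quad (F : Type*) [Field F] {k₁ k₂ : ℕ} (a : Fin k₁ ⊕ Fin k₂) : Ambient (Mat F k₁ k₂) :=
  symUnit F a a 0 (del1 (blk a))

/-- The eigenvalue of the first product with `quad a` on the `m`-th derivative of the generator
with index `a`. -/
def eig (F : Type*) [Field F] {k₁ k₂ : ℕ} (a : Fin k₁ ⊕ Fin k₂) (m : ℕ) : F :=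
  Sum.elim (fun _ => 2 * ((m : F) + 1)) (fun _ => -(2 * (m : F) + 1)) a

/-- The first products with the `quad a` are simultaneously diagonal on the units; each slot equal
to `a` contributes its own eigenvalue. This family plays the role of a Cartan subalgebra below. -/
theorem mul_one_quad_unit (a b c : Fin k₁ ⊕ Fin k₂) (m n : ℕ) :
    mul F 1 (quad F a) (unit F b c m n) =
      ((if b = a then eig F a m else 0) + (if c = a then eig F a n else 0)) • unit F b c m n := by
  rw [quad, mul_symUnit_unit, mul_unit, mul_unit]
  simp only [eq_comm (a := a)]
  rcases a with p | r
  · by_cases hb : b = .inl p <;> by_cases hc : c = .inl p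
    · subst hb hc
      simp [coeffLeft, coeffRight, sgn_zero_right, del0, del1, eig]
      module
    · subst hb
      simp [coeffLeft, sgn_zero_right, del0, del1, hc, eig]
      module
    · subst hc
      simp [coeffRight, sgn_zero_right, del0, del1, hb, eig]
      module
    · simp [hb, hc]
  · by_cases hb : b = .inr r <;> by_cases hc : c = .inr r
    · subst hb hc
      simp [coeffLeft, coeffRight, sgn_one_one, del0, del1, eig, one_add_one_eq_zero_zmod]
      module
    · subst hb
      simp [coeffLeft, sgn_one_one, del0, del1, hc, eig]
      module
    · subst hc
      simp [coeffRight, sgn_one_one, del0, del1, hb, eig, one_add_one_eq_zero_zmod]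
      module
    · simp [hb, hc]

/-- Unlike ∂, this raises a single exponent, so odd units with arbitrary exponents can be reached
from exponents zero. -/
theorem mul_zero_quad_inl (p : Fin k₁) (r : Fin k₂) (m n : ℕ) :
    mul F 0 (quad F (.inl p)) (symUnit F (.inl p) (.inr r) m n) =
      (2 * ((m : F) + 1)) • symUnit F (.inl p) (.inr r) (m + 1) n := by
  rw [quad, mul_symUnit, mul_symUnit_unit, mul_unit, mul_unit, symUnit_eq]
  simp [coeffLeft, sgn_zero_right, del0, del1]
  module

theorem mul_zero_quad_inr (p : Fin k₁) (r : Fin k₂) (m n : ℕ) :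
    mul F 0 (quad F (.inr r)) (symUnit F (.inl p) (.inr r) m n) =
      (-2 * ((n : F) + 1)) • symUnit F (.inl p) (.inr r) m (n + 1) := by
  rw [quad, mul_symUnit, mul_symUnit_unit, mul_unit, mul_unit, symUnit_eq]
  simp [coeffRight, sgn_one_one, del0, del1, one_add_one_eq_zero_zmod, add_comm 1 n]
  module

/-- The `j`-th product with a quadratic element shifts the exponent by `1 - j`, so `j = m + 1` sends
`m` to 0. -/
theorem lower_inl (p : Fin k₁) (r : Fin k₂) (m n : ℕ) :
    mul F (m + 1) (quad F (.inl p)) (symUnit F (.inl p) (.inr r) m n) =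
      (2 * ((m : F) + 1)) • symUnit F (.inl p) (.inr r) 0 n := by
  rw [quad, mul_symUnit, mul_symUnit_unit, mul_unit, mul_unit, symUnit_eq]
  simp [coeffLeft, sgn_zero_right, del0, del1]
  module

theorem lower_inr (p : Fin k₁) (r : Fin k₂) (m n : ℕ) :
    mul F (n + 1) (quad F (.inr r)) (symUnit F (.inl p) (.inr r) m n) =
      (-((n : F) + 1)) • symUnit F (.inl p) (.inr r) m 0 := by
  rw [quad, mul_symUnit, mul_symUnit_unit, mul_unit, mul_unit, symUnit_eq]
  simp [coeffRight, sgn_one_one, del0, del1, one_add_one_eq_zero_zmod, add_comm 1 n]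
  module

/-- The action of `(α_p ψ_r)₀` on products containing a derivative of `ψ_r`. -/
theorem mul_zero_odd (p q : Fin k₁) (r : Fin k₂) (m n : ℕ) :
    mul F 0 (symUnit F (.inl p) (.inr r) 0 0) (symUnit F (.inl q) (.inr r) m n) =
      symUnit F (.inl q) (.inl p) m n +
        (if p = q then ((m : F) + 1) else 0) • symUnit F (.inr r) (.inr r) (m + 1) n := by
  rw [mul_symUnit, mul_symUnit_unit, mul_unit, mul_unit, symUnit_eq, symUnit_eq]
  by_cases h : p = q
  · subst h
    simp [coeffLeft, coeffRight, sgn_zero_left, del0, del1,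
      val_one_zmod]
    abel
  · simp [coeffRight, sgn_zero_left, del0, del1,
      val_one_zmod, h]

/-- The action of `(α_p ψ_s)₁` on products containing a derivative of `α_p`. -/
theorem mul_one_odd (p : Fin k₁) (r s : Fin k₂) (m n : ℕ) :
    mul F 1 (symUnit F (.inl p) (.inr s) 0 0) (symUnit F (.inl p) (.inr r) m n) =
      ((m : F) + 1) • symUnit F (.inr s) (.inr r) m n +
        (if r = s ∧ 1 ≤ n then 1 else 0 : F) • symUnit F (.inl p) (.inl p) m (n - 1) := by
  rw [mul_symUnit, mul_symUnit_unit, mul_unit, mul_unit, symUnit_eq, symUnit_eq]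
  by_cases h : r = s
  · subst h
    simp [coeffLeft, coeffRight, sgn_zero_left, del0, del1,
      val_one_zmod]
    split_ifs
    · abel
    · simp
  · simp [coeffLeft, sgn_zero_left, del0, h, Ne.symm h]

theorem mul_one_odd_inl (p q : Fin k₁) (r : Fin k₂) (m n : ℕ) (h : p ≠ q) :
    mul F 1 (symUnit F (.inl q) (.inr r) 0 0) (symUnit F (.inl p) (.inl q) m n) =
      ((n : F) + 1) • symUnit F (.inl p) (.inr r) m n := by
  rw [mul_symUnit, mul_symUnit_unit, mul_unit, mul_unit, symUnit_eq]
  simp [coeffRight, sgn_zero_left, del0, del1,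
      val_one_zmod, Ne.symm h]

theorem mul_zero_odd_inr (p : Fin k₁) (r s : Fin k₂) (m n : ℕ) (h : r ≠ s) :
    mul F 0 (symUnit F (.inl p) (.inr r) 0 0) (symUnit F (.inr r) (.inr s) m n) =
      symUnit F (.inl p) (.inr s) m n := by
  rw [mul_symUnit, mul_symUnit_unit, mul_unit, mul_unit, symUnit_eq]
  simp [coeffLeft, sgn_zero_left, del0, h]

theorem mul_zero_odd_same (p : Fin k₁) (r s : Fin k₂) (h : r ≠ s) :
    mul F 0 (symUnit F (.inl p) (.inr r) 0 0) (symUnit F (.inl p) (.inr s) 0 0) =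
      symUnit F (.inr r) (.inr s) 1 0 := by
  rw [mul_symUnit, mul_symUnit_unit, mul_unit, mul_unit, symUnit_eq]
  simp [coeffLeft, sgn_zero_left, del0, h]

theorem mul_one_even_inl (p q : Fin k₁) (h : p ≠ q) :
    mul F 1 (symUnit F (k₂ := k₂) (.inl p) (.inl q) 0 0) (symUnit F (.inl p) (.inl q) 0 0) =
      quad F (.inl p) + quad F (.inl q) := by
  rw [mul_symUnit, mul_symUnit_unit, mul_unit, mul_unit, quad, quad, symUnit_eq, symUnit_eq]
  simp [coeffLeft, coeffRight, sgn_zero_right, del0, del1,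
      h, Ne.symm h]
  abel

theorem mul_one_even_inr (r s : Fin k₂) (h : r ≠ s) :
    mul F 1 (symUnit F (.inr r) (.inr s) 1 0) (symUnit F (k₁ := k₁) (.inr r) (.inr s) 1 0) =
      (-2 : F) • quad F (.inr s) := by
  rw [mul_symUnit, mul_symUnit_unit, mul_unit, mul_unit, quad, symUnit_eq]
  simp [coeffLeft, coeffRight, sgn_one_one, del0, del1,
      one_add_one_eq_zero_zmod, h, Ne.symm h, twist_unit]
  module

variable {F : Type*} [Field F] {k₁ k₂ : ℕ}

theorem mul_one_quad_symUnit (a b c : Fin k₁ ⊕ Fin k₂) (m n : ℕ) :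
    mul F 1 (quad F a) (symUnit F b c m n) =
      ((if b = a then eig F a m else 0) + (if c = a then eig F a n else 0)) •
        symUnit F b c m n := by
  rw [quad, mul_symUnit, ← quad, mul_one_quad_unit, map_smul, ← smul_add, ← symUnit_eq]

theorem quad_mem_starAlg (a : Fin k₁ ⊕ Fin k₂) : quad F a ∈ starAlg F k₁ k₂ :=
  symUnit_mem_starAlg _ _ _ _

/-- The minus sign comes from the antisymmetry of the second block, which exchanges the exponents
(1, 0) and (0, 1). -/
theorem mul_zero_odd_self (p : Fin k₁) (r : Fin k₂) :
    mul F 0 (symUnit F (.inl p) (.inr r) 0 0) (symUnit F (.inl p) (.inr r) 0 0) =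
      quad F (.inl p) - quad F (.inr r) := by
  rw [mul_zero_odd, quad, quad, symUnit_swap (Sum.inr r) (Sum.inr r) 0 1]
  simp [del1, sgn_one_one, sub_eq_add_neg]

/-! ### Eigenvalues and generation. -/

variable [CharZero F]

theorem eig_ne_zero (a : Fin k₁ ⊕ Fin k₂) (m : ℕ) : eig F a m ≠ 0 := by
  rcases a with p | r
  · simp only [eig, Sum.elim_inl]
    exact_mod_cast (by omega : 2 * (m + 1) ≠ 0)
  · simp only [eig, Sum.elim_inr, ne_eq, neg_eq_zero]
    exact_mod_cast (by omega : 2 * m + 1 ≠ 0)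

/-- For a fixed index the eigenvalues are images of nonzero integers of the same sign, so they
cannot cancel in characteristic 0. -/
theorem eig_add_eig_ne_zero (a : Fin k₁ ⊕ Fin k₂) (m n : ℕ) : eig F a m + eig F a n ≠ 0 := by
  rcases a with p | r
  · simp only [eig, Sum.elim_inl]
    exact_mod_cast (by omega : 2 * (m + 1) + 2 * (n + 1) ≠ 0)
  · simp only [eig, Sum.elim_inr, ne_eq, ← neg_add, neg_eq_zero]
    exact_mod_cast (by omega : 2 * m + 1 + (2 * n + 1) ≠ 0)

theorem eig_injective (a : Fin k₁ ⊕ Fin k₂) : Function.Injective (eig F a) := by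
  intro m n h
  rcases a with p | r
  · simpa [eig] using h
  · simpa [eig] using h

theorem eig_total_ne_zero {a b c : Fin k₁ ⊕ Fin k₂} (m n : ℕ) (h : b = a ∨ c = a) :
    (if b = a then eig F a m else 0) + (if c = a then eig F a n else 0) ≠ 0 := by
  split_ifs with h1 h2 h2
  · exact eig_add_eig_ne_zero a m n
  · simpa using eig_ne_zero a m
  · simpa using eig_ne_zero a n
  · tauto

omit [CharZero F] in
theorem mem_of_smul_mem {V : Type*} [AddCommGroup V] [Module F V] {J : Submodule F V} {c : F}
    {x : V} (hc : c ≠ 0) (h : c • x ∈ J) : x ∈ J :=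
  (Submodule.smul_mem_iff _ hc).1 h

/-- The first product with `quad a` separates the elements that involve the index `a` from those
that do not. -/
theorem symUnit_mem_of_add_mem {J : Submodule F (Ambient (Mat F k₁ k₂))}
    {a b c b' c' : Fin k₁ ⊕ Fin k₂} {m n m' n' : ℕ} {s t : F}
    (hJ : ∀ x ∈ J, mul F 1 (quad F a) x ∈ J) (hbc : b = a ∨ c = a) (hb' : b' ≠ a) (hc' : c' ≠ a)
    (hs : s ≠ 0) (h : s • symUnit F b c m n + t • symUnit F b' c' m' n' ∈ J) :
    symUnit F b c m n ∈ J := by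
  have h1 := hJ _ h
  rw [map_add, map_smul, map_smul, mul_one_quad_symUnit a b', if_neg hb', if_neg hc', add_zero,
    zero_smul, smul_zero, add_zero, mul_one_quad_symUnit] at h1
  have h2 := mem_of_smul_mem hs h1
  exact mem_of_smul_mem (eig_total_ne_zero m n hbc) h2

/-- The odd generators and the quadratic elements `quad a` generate everything. -/
theorem symUnit_mem_of_generators {J : Submodule F (Ambient (Mat F k₁ k₂))}
    (hmul : ∀ n, ∀ x ∈ J, ∀ y ∈ J, mul F n x y ∈ J) (hquad : ∀ a, quad F a ∈ J)
    (hodd : ∀ (p : Fin k₁) (r : Fin k₂), symUnit F (.inl p) (.inr r) 0 0 ∈ J)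
    (p₀ : Fin k₁) (r₀ : Fin k₂) (a b : Fin k₁ ⊕ Fin k₂) (m n : ℕ) :
    symUnit F a b m n ∈ J := by
  have h1 : ∀ (p : Fin k₁) (r : Fin k₂) (m n : ℕ), symUnit F (.inl p) (.inr r) m n ∈ J := by
    intro p r m n
    induction m with
    | zero =>
      induction n with
      | zero => exact hodd p r
      | succ n ih =>
        have h := hmul 0 _ (hquad (.inr r)) _ ih
        rw [mul_zero_quad_inr] at h
        refine mem_of_smul_mem ?_ h
        exact mul_ne_zero (by norm_num) (by exact_mod_cast n.succ_ne_zero)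
    | succ m ih =>
      have h := hmul 0 _ (hquad (.inl p)) _ ih
      rw [mul_zero_quad_inl] at h
      refine mem_of_smul_mem ?_ h
      exact mul_ne_zero (by norm_num) (by exact_mod_cast m.succ_ne_zero)
  rcases a with p | r <;> rcases b with q | s
  -- If `p = q`, an unwanted unit in the index `r₀` also appears; it does not involve `q`, so the
  -- first product with `quad (.inl q)` kills it.
  · have h := hmul 0 _ (hodd q r₀) _ (h1 p r₀ m n)
    rw [mul_zero_odd, ← one_smul F (symUnit F _ _ m n)] at h
    exact symUnit_mem_of_add_mem (hmul 1 _ (hquad (.inl q))) (Or.inr rfl) (by simp) (by simp)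
      one_ne_zero h
  · exact h1 p s m n
  · rw [symUnit_swap]
    exact Submodule.smul_mem _ _ (h1 q r n m)
  · have h := hmul 1 _ (hodd p₀ r) _ (h1 p₀ s m n)
    rw [mul_one_odd] at h
    have h2 : (m : F) + 1 ≠ 0 := by exact_mod_cast m.succ_ne_zero
    exact symUnit_mem_of_add_mem (hmul 1 _ (hquad (.inr r))) (Or.inl rfl) (by simp) (by simp) h2 h

omit [CharZero F] in
/-- All the elements `quad a` are obtained from the odd generators and one of them. -/
theorem quad_mem_of_generators {J : Submodule F (Ambient (Mat F k₁ k₂))}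
    (hmul : ∀ n, ∀ x ∈ J, ∀ y ∈ J, mul F n x y ∈ J)
    (hodd : ∀ (p : Fin k₁) (r : Fin k₂), symUnit F (.inl p) (.inr r) 0 0 ∈ J)
    (p₀ : Fin k₁) (r₀ : Fin k₂) {b : Fin k₁ ⊕ Fin k₂} (hb : quad F b ∈ J)
    (a : Fin k₁ ⊕ Fin k₂) : quad F a ∈ J := by
  have h : ∀ p r, quad F (.inl p : Fin k₁ ⊕ Fin k₂) - quad F (.inr r) ∈ J := fun p r => by
    rw [← mul_zero_odd_self]; exact hmul 0 _ (hodd p r) _ (hodd p r)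
  have h0 : quad F (.inl p₀ : Fin k₁ ⊕ Fin k₂) ∈ J := by
    rcases b with p | r
    · have := add_mem (sub_mem hb (h p r₀)) (h p₀ r₀)
      simpa using this
    · simpa using add_mem hb (h p₀ r)
  have h1 : ∀ r, quad F (.inr r : Fin k₁ ⊕ Fin k₂) ∈ J := fun r => by
    simpa using sub_mem h0 (h p₀ r)
  rcases a with p | r
  · simpa using add_mem (h1 r₀) (h p r₀)
  · exact h1 r

/-- Differences of `quad`s are always available. With two indices in the first block, the first
product of α_pα_q with itself is a sum of two `quad`s, and adding differences leaves twice one of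
them. With two indices in the second block, the analogous product is already `-2` times a single
`quad`. -/
theorem exists_quad_mem {J : Submodule F (Ambient (Mat F k₁ k₂))}
    (hmul : ∀ n, ∀ x ∈ J, ∀ y ∈ J, mul F n x y ∈ J)
    (hodd : ∀ (p : Fin k₁) (r : Fin k₂), symUnit F (.inl p) (.inr r) 0 0 ∈ J)
    (h₁ : 0 < k₁) (h₂ : 0 < k₂) (hk : 2 < k₁ + k₂) :
    ∃ b : Fin k₁ ⊕ Fin k₂, quad F b ∈ J := by
  have h : ∀ p r, quad F (.inl p : Fin k₁ ⊕ Fin k₂) - quad F (.inr r) ∈ J := fun p r => by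
    rw [← mul_zero_odd_self]; exact hmul 0 _ (hodd p r) _ (hodd p r)
  rcases (show 2 ≤ k₁ ∨ 2 ≤ k₂ by omega) with h2 | h2
  · set p : Fin k₁ := ⟨0, by omega⟩
    set q : Fin k₁ := ⟨1, by omega⟩
    have hpq : p ≠ q := by simp [p, q]
    set r : Fin k₂ := ⟨0, h₂⟩
    have hS : symUnit F (.inl p : Fin k₁ ⊕ Fin k₂) (.inl q) 0 0 ∈ J := by
      have := hmul 0 _ (hodd q r) _ (hodd p r)
      rwa [mul_zero_odd, if_neg hpq.symm, zero_smul, add_zero] at this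
    have hS2 := hmul 1 _ hS _ hS
    rw [mul_one_even_inl p q hpq] at hS2
    refine ⟨.inl p, mem_of_smul_mem (two_ne_zero (α := F)) ?_⟩
    have := sub_mem (add_mem hS2 (h p r)) (h q r)
    convert this using 1
    module
  · set r : Fin k₂ := ⟨0, by omega⟩
    set s : Fin k₂ := ⟨1, by omega⟩
    have hrs : r ≠ s := by simp [r, s]
    set p : Fin k₁ := ⟨0, h₁⟩
    have hS : symUnit F (.inr r : Fin k₁ ⊕ Fin k₂) (.inr s) 1 0 ∈ J := by
      have := hmul 0 _ (hodd p r) _ (hodd p s)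
      rwa [mul_zero_odd_same p r s hrs] at this
    have hS2 := hmul 1 _ hS _ hS
    rw [mul_one_even_inr r s hrs] at hS2
    exact ⟨.inr s, mem_of_smul_mem (by norm_num) hS2⟩

theorem isGeneratedBy_of_generators (h₁ : 0 < k₁) (h₂ : 0 < k₂) {S : Set (starAlg F k₁ k₂)}
    (hS : ∀ u ∈ S, ∃ i, u ∈ (starConformal F k₁ k₂).parity i)
    (hodd : ∀ (p : Fin k₁) (r : Fin k₂),
      (⟨symUnit F (.inl p) (.inr r) 0 0, symUnit_mem_starAlg _ _ _ _⟩ : starAlg F k₁ k₂) ∈ S)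
    (hk : 2 < k₁ + k₂ ∨ ∃ b, (⟨quad F b, quad_mem_starAlg b⟩ : starAlg F k₁ k₂) ∈ S) :
    (starConformal F k₁ k₂).IsGeneratedBy S := by
  set T := Submodule.span F {x | (starConformal F k₁ k₂).IsNested S x}
  set J := T.map (starAlg F k₁ k₂).subtype
  have hJ : ∀ x (hx : x ∈ S), (x : Ambient (Mat F k₁ k₂)) ∈ J := fun x hx =>
    Submodule.mem_map_of_mem (f := (starAlg F k₁ k₂).subtype)
      (Submodule.subset_span (ConformalSuperalgebra.IsNested.base x hx))
  have hmul : ∀ n, ∀ x ∈ J, ∀ y ∈ J, mul F n x y ∈ J := by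
    rintro n _ ⟨x, hx, rfl⟩ _ ⟨y, hy, rfl⟩
    exact ⟨_, ConformalSuperalgebra.mul_mem_span_isNested hS n hx hy, rfl⟩
  have hodd' : ∀ (p : Fin k₁) (r : Fin k₂), symUnit F (.inl p) (.inr r) 0 0 ∈ J :=
    fun p r => hJ _ (hodd p r)
  have hb : ∃ b : Fin k₁ ⊕ Fin k₂, quad F b ∈ J := by
    rcases hk with hk | ⟨b, hb⟩
    · exact exists_quad_mem hmul hodd' h₁ h₂ hk
    · exact ⟨b, hJ _ hb⟩
  obtain ⟨b, hb⟩ := hb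
  have hall := symUnit_mem_of_generators hmul
    (quad_mem_of_generators hmul hodd' ⟨0, h₁⟩ ⟨0, h₂⟩ hb) hodd' ⟨0, h₁⟩ ⟨0, h₂⟩
  have hle : starAlg F k₁ k₂ ≤ J := by
    rw [starAlg_eq_span, Submodule.span_le]
    rintro x ⟨a, b, m, n, rfl⟩
    exact hall a b m n
  refine eq_top_iff.2 fun x _ => ?_
  obtain ⟨y, hy, hyx⟩ := hle x.2
  rwa [← Subtype.ext hyx]

/-! ### Coordinates and projection to joint eigenspaces. -/

/-- A subspace of finitely supported functions that is stable under the multiplication by a family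
of functions contains the projections to the joint eigenspaces. -/
theorem filter_mem_of_diagonal {F ι κ : Type*} [Field F] (d : κ → ι → F)
    (J : Submodule F (ι →₀ F))
    (hJ : ∀ k, ∀ f ∈ J, ∀ g : ι →₀ F, (∀ i, g i = d k i * f i) → g ∈ J) (j : ι)
    (f : ι →₀ F) (hf : f ∈ J) [DecidablePred fun i => ∀ k, d k i = d k j] :
    f.filter (fun i => ∀ k, d k i = d k j) ∈ J := by
  classical
  induction hn : (f.support.filter fun i => ¬ ∀ k, d k i = d k j).card
    using Nat.strong_induction_on generalizing f with
  | _ n ih =>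
    by_cases h : ∃ i ∈ f.support, ¬ ∀ k, d k i = d k j
    · obtain ⟨i, hi, hk⟩ := h
      obtain ⟨k, hk⟩ := not_forall.1 hk
      have hk' : d k j - d k i ≠ 0 := sub_ne_zero.2 (Ne.symm hk)
      let g : ι →₀ F := Finsupp.onFinset f.support (fun i => d k i * f i) fun x hx => by
        simp only [Finsupp.mem_support_iff]
        exact right_ne_zero_of_mul hx
      have hg : g ∈ J := hJ k f hf g fun _ => rfl
      -- This combination vanishes at `i` and, by the normalisation, agrees with `f` on the joint
      -- eigenspace of `j`. Hence the support outside that eigenspace shrinks.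
      let f' : ι →₀ F := (d k j - d k i)⁻¹ • (g - d k i • f)
      have hf' : f' ∈ J := Submodule.smul_mem _ _ (sub_mem hg (Submodule.smul_mem _ _ hf))
      have hval : ∀ x, f' x = (d k j - d k i)⁻¹ * ((d k x - d k i) * f x) := fun x => by
        simp only [f', g, Finsupp.smul_apply, Finsupp.sub_apply, Finsupp.onFinset_apply,
          smul_eq_mul, sub_mul]
      have hfilter : f'.filter (fun i => ∀ k, d k i = d k j) =
          f.filter (fun i => ∀ k, d k i = d k j) := by
        ext x
        by_cases hx : ∀ k, d k x = d k j
        · rw [Finsupp.filter_apply_pos _ _ hx, Finsupp.filter_apply_pos _ _ hx, hval, hx k,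
            inv_mul_cancel_left₀ hk']
        · rw [Finsupp.filter_apply_neg _ _ hx, Finsupp.filter_apply_neg _ _ hx]
      rw [← hfilter]
      refine ih _ ?_ f' hf' rfl
      rw [← hn]
      refine Finset.card_lt_card ⟨?_, ?_⟩
      · intro x hx
        simp only [Finset.mem_filter, Finsupp.mem_support_iff, hval] at hx ⊢
        exact ⟨right_ne_zero_of_mul (right_ne_zero_of_mul hx.1), hx.2⟩
      · intro hsub
        have := hsub (Finset.mem_filter.2 ⟨hi, fun h => hk (h k)⟩)
        simp [hval] at this
    · push Not at h
      rwa [Finsupp.filter_eq_self_iff _ _ |>.2]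
      intro x hx
      exact h x (Finsupp.mem_support_iff.2 hx)

variable {F : Type*} [Field F] {k₁ k₂ : ℕ}

/-- The indices of the elements `unit`. -/
abbrev UnitIndex (k₁ k₂ : ℕ) : Type := ((Fin k₁ ⊕ Fin k₂) × (Fin k₁ ⊕ Fin k₂)) × (ℕ × ℕ)

/-- The linear combination of the elements `unit` with given coefficients. -/
def comb (F : Type*) [Field F] (k₁ k₂ : ℕ) :
    (UnitIndex k₁ k₂ →₀ F) →ₗ[F] Ambient (Mat F k₁ k₂) :=
  Finsupp.linearCombination F fun i => unit F i.1.1 i.1.2 i.2.1 i.2.2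

theorem comb_single (i : UnitIndex k₁ k₂) (c : F) :
    comb F k₁ k₂ (Finsupp.single i c) = c • unit F i.1.1 i.1.2 i.2.1 i.2.2 := by
  simp [comb]

/-- The coefficient of `unit` in an element. -/
def coord (F : Type*) [Field F] {k₁ k₂ : ℕ} (i : UnitIndex k₁ k₂) :
    Ambient (Mat F k₁ k₂) →ₗ[F] F :=
  (Matrix.entryLinearMap F F i.1.1 i.1.2).comp (Finsupp.lapply ((blk i.1.1, blk i.1.2), i.2))

theorem coord_unit (i : UnitIndex k₁ k₂) (p q : Fin k₁ ⊕ Fin k₂) (m n : ℕ) :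
    coord F i (unit F p q m n) = if ((p, q), (m, n)) = i then 1 else 0 := by
  obtain ⟨⟨p', q'⟩, m', n'⟩ := i
  by_cases h : (((p, q), (m, n)) : UnitIndex k₁ k₂) = ((p', q'), m', n')
  · rw [if_pos h]
    simp only [Prod.mk.injEq] at h
    obtain ⟨⟨rfl, rfl⟩, rfl, rfl⟩ := h
    simp [coord, unit, E, elt]
  · rw [if_neg h]
    by_cases hp : p = p'
    · by_cases hq : q = q'
      · subst hp hq
        have : ¬ ((m, n) = (m', n')) := fun h' => h (by rw [h'])
        simp only [coord, unit, E, elt, LinearMap.comp_apply, Finsupp.lapply_apply]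
        rw [Finsupp.single_eq_of_ne (by simpa [eq_comm] using this)]
        simp
      · simp only [coord, unit, E, elt, LinearMap.comp_apply, Finsupp.lapply_apply,
          Finsupp.single_apply]
        split_ifs <;> simp [hq]
    · simp only [coord, unit, E, elt, LinearMap.comp_apply, Finsupp.lapply_apply,
        Finsupp.single_apply]
      split_ifs <;> simp [hp]

theorem coord_comb (i : UnitIndex k₁ k₂) (f : UnitIndex k₁ k₂ →₀ F) :
    coord F i (comb F k₁ k₂ f) = f i := by
  induction f using Finsupp.induction_linear with
  | zero => simp
  | add f g hf hg => rw [map_add, map_add, hf, hg, Finsupp.add_apply]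
  | single j c =>
    rw [comb_single, map_smul, coord_unit, Finsupp.single_apply]
    simp

theorem range_comb : LinearMap.range (comb F k₁ k₂) = blockAlg F k₁ k₂ 0 := by
  rw [comb, Finsupp.range_linearCombination, blockAlg_eq_span]
  congr 1
  ext x
  constructor
  · rintro ⟨i, rfl⟩; exact ⟨_, _, _, _, rfl⟩
  · rintro ⟨p, q, m, n, rfl⟩; exact ⟨((p, q), (m, n)), rfl⟩

theorem coord_twist (p q : Fin k₁ ⊕ Fin k₂) (m n : ℕ) {x : Ambient (Mat F k₁ k₂)}
    (hx : x ∈ starAlg F k₁ k₂) : coord F ((q, p), (n, m)) x =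
      ((sgn (blk p) (blk q) : ℤ) : F) * coord F ((p, q), (m, n)) x := by
  rw [starAlg_eq_span] at hx
  induction hx using Submodule.span_induction with
  | mem x hx =>
    obtain ⟨a, b, m', n', rfl⟩ := hx
    have hs : ((sgn (blk p) (blk q) : ℤ) : F) * ((sgn (blk p) (blk q) : ℤ) : F) = 1 := by
      exact_mod_cast congrArg (Int.cast : ℤ → F) (sgn_mul_self (blk p) (blk q))
    simp only [symUnit, map_add, map_smul, coord_unit, smul_eq_mul, Prod.mk.injEq]
    by_cases h1 : (a = p ∧ b = q) ∧ m' = m ∧ n' = n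
    · obtain ⟨⟨rfl, rfl⟩, rfl, rfl⟩ := h1
      simp only [and_self, if_true, mul_one]
      rw [mul_add, ← mul_assoc, hs]
      by_cases h2 : (a = b ∧ b = a) ∧ m' = n' ∧ n' = m'
      · simp [h2.1.1, h2.2.1, add_comm]
      · rw [if_neg h2, if_neg (by tauto)]; simp
    · by_cases h2 : (b = p ∧ a = q) ∧ n' = m ∧ m' = n
      · obtain ⟨⟨rfl, rfl⟩, rfl, rfl⟩ := h2
        rw [if_neg h1, if_pos (by tauto), if_neg (by tauto), if_pos (by tauto), sgn_comm (blk a),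
          mul_one, zero_add, hs, mul_zero, add_zero]
      · rw [if_neg h1, if_neg h2, if_neg (by tauto), if_neg (by tauto)]; simp
  | zero => simp
  | add x y _ _ hx hy => rw [map_add, hx, hy, map_add, mul_add]
  | smul c x _ hx => rw [map_smul, map_smul, hx, smul_eq_mul, smul_eq_mul, mul_left_comm]

variable [CharZero F]

/-- The eigenvalues of the first products with the elements `quad a`. -/
def weight (F : Type*) [Field F] {k₁ k₂ : ℕ} (a : Fin k₁ ⊕ Fin k₂) (i : UnitIndex k₁ k₂) : F :=
  (if i.1.1 = a then eig F a i.2.1 else 0) + (if i.1.2 = a then eig F a i.2.2 else 0)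

/-- Nonvanishing of the eigenvalues detects which indices occur, and for distinct indices
`eig_injective` recovers each exponent separately. -/
theorem eq_or_eq_swap_of_weight_eq {p q : Fin k₁ ⊕ Fin k₂} (hpq : p ≠ q) {m n : ℕ}
    {i : UnitIndex k₁ k₂} (h : ∀ a, weight F a i = weight F a ((p, q), (m, n))) :
    i = ((p, q), (m, n)) ∨ i = ((q, p), (n, m)) := by
  obtain ⟨⟨p', q'⟩, m', n'⟩ := i
  have hp := h p
  have hq := h q
  simp only [weight, if_true, hpq, Ne.symm hpq, if_false, add_zero, zero_add] at hp hq
  by_cases h1 : p' = p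
  · subst h1
    have h2 : q' = q := by
      by_contra h2
      rw [if_neg hpq, if_neg h2, add_zero] at hq
      exact eig_ne_zero q n hq.symm
    subst h2
    simp only [if_true, Ne.symm hpq, hpq, if_false, add_zero, zero_add] at hp hq
    rw [eig_injective _ hp, eig_injective _ hq]
    exact Or.inl rfl
  · have h2 : q' = p := by
      by_contra h2
      rw [if_neg h1, if_neg h2, add_zero] at hp
      exact eig_ne_zero p m hp.symm
    subst h2
    have h3 : p' = q := by
      by_contra h3
      rw [if_neg hpq, if_neg h3, add_zero] at hq
      exact eig_ne_zero q n hq.symm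
    subst h3
    simp only [if_true, Ne.symm hpq, hpq, if_false, add_zero, zero_add] at hp hq
    rw [eig_injective _ hp, eig_injective _ hq]
    exact Or.inr rfl

/-- For a repeated index only the indices are recovered: the eigenvalue depends on the exponents
only through their sum. -/
theorem fst_eq_of_weight_eq {p : Fin k₁ ⊕ Fin k₂} {m n : ℕ}
    {i : UnitIndex k₁ k₂} (h : ∀ a, weight F a i = weight F a ((p, p), (m, n))) :
    i.1 = (p, p) := by
  obtain ⟨⟨p', q'⟩, m', n'⟩ := i
  have h1 : p' = p := by
    by_contra hne
    have := h p'
    refine eig_total_ne_zero (F := F) (b := p') (c := q') m' n' (Or.inl rfl) ?_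
    refine this.trans ?_
    simp [weight, Ne.symm hne]
  have h2 : q' = p := by
    by_contra hne
    have := h q'
    refine eig_total_ne_zero (F := F) (b := p') (c := q') m' n' (Or.inr rfl) ?_
    refine this.trans ?_
    simp [weight, Ne.symm hne]
  rw [h1, h2]

omit [CharZero F] in
theorem mul_one_quad_comb (a : Fin k₁ ⊕ Fin k₂) (f g : UnitIndex k₁ k₂ →₀ F)
    (h : ∀ i, g i = weight F a i * f i) :
    comb F k₁ k₂ g = mul F 1 (quad F a) (comb F k₁ k₂ f) := by
  have hg : g = Finsupp.lsum F (fun i => weight F a i •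
      (Finsupp.lsingle i : F →ₗ[F] UnitIndex k₁ k₂ →₀ F)) f := by
    ext j
    rw [h j]
    clear h
    induction f using Finsupp.induction_linear with
    | zero => simp
    | add f g hf hg => rw [map_add, Finsupp.add_apply, Finsupp.add_apply, mul_add, hf, hg]
    | single i c =>
      by_cases hij : i = j
      · subst hij; simp
      · simp [hij]
  rw [hg]
  clear h hg
  induction f using Finsupp.induction_linear with
  | zero => simp
  | add f g hf hg => simp only [map_add, hf, hg]
  | single i c =>
    rw [comb_single, map_smul, mul_one_quad_unit, Finsupp.lsum_single, LinearMap.smul_apply,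
      map_smul, Finsupp.lsingle_apply, comb_single, smul_comm]
    rfl

section Ideal

variable {J : Submodule F (Ambient (Mat F k₁ k₂))} (hle : J ≤ starAlg F k₁ k₂)
  (hJ : ∀ n, ∀ u ∈ starAlg F k₁ k₂, ∀ x ∈ J, mul F n u x ∈ J)

include hJ in
open Classical in
theorem comb_filter_mem (f : UnitIndex k₁ k₂ →₀ F) (hf : comb F k₁ k₂ f ∈ J)
    (j : UnitIndex k₁ k₂) :
    comb F k₁ k₂ (f.filter fun i => ∀ a, weight F a i = weight F a j) ∈ J :=
  filter_mem_of_diagonal (weight F) (J.comap (comb F k₁ k₂)) (fun a f hf g hg => by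
    rw [Submodule.mem_comap, mul_one_quad_comb a f g hg]
    exact hJ 1 _ (quad_mem_starAlg a) _ hf) j f hf

-- The projection of `x` to the joint eigenspace involves only a unit and its transpose. Invariance
-- under `twist` ties their coefficients together, which leaves a multiple of one symmetric unit.
include hle hJ in
theorem symUnit_mem_of_coord_ne_zero {p q : Fin k₁ ⊕ Fin k₂} (hpq : p ≠ q) {m n : ℕ}
    {x : Ambient (Mat F k₁ k₂)} (hx : x ∈ J) (hc : coord F ((p, q), (m, n)) x ≠ 0) :
    symUnit F p q m n ∈ J := by
  classical
  obtain ⟨f, rfl⟩ : x ∈ LinearMap.range (comb F k₁ k₂) := by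
    rw [range_comb]; exact starAlg_le_blockAlg (hle hx)
  have h := comb_filter_mem hJ f hx ((p, q), (m, n))
  have ht := coord_twist p q m n (hle hx)
  rw [coord_comb] at hc
  rw [coord_comb, coord_comb] at ht
  have hf : f.filter (fun i => ∀ a, weight F a i = weight F a ((p, q), (m, n))) =
      Finsupp.single ((p, q), (m, n)) (f ((p, q), (m, n))) +
        Finsupp.single ((q, p), (n, m)) (f ((q, p), (n, m))) := by
    have hne : (((q, p), (n, m)) : UnitIndex k₁ k₂) ≠ ((p, q), (m, n)) := by
      simp [Ne.symm hpq]
    have hw : ∀ a, weight F a ((q, p), (n, m)) = weight F a ((p, q), (m, n)) := fun a => by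
      simp only [weight]; rw [add_comm]
    ext i
    by_cases hi : ∀ a, weight F a i = weight F a ((p, q), (m, n))
    · rw [Finsupp.filter_apply_pos _ _ hi]
      rcases eq_or_eq_swap_of_weight_eq hpq hi with rfl | rfl
      · simp [hne]
      · simp [hne.symm]
    · rw [Finsupp.filter_apply_neg _ _ hi]
      have h1 : i ≠ ((p, q), (m, n)) := by rintro rfl; exact hi fun _ => rfl
      have h2 : i ≠ ((q, p), (n, m)) := by rintro rfl; exact hi hw
      simp [h1.symm, h2.symm]
  rw [hf, map_add, comb_single, comb_single, ht, mul_comm, mul_smul, ← smul_add] at h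
  exact mem_of_smul_mem hc h

end Ideal

/-! ### Simplicity. -/

variable {F : Type*} [Field F] {k₁ k₂ : ℕ}

/-- Moves units with a repeated index, where exponents are not separated by eigenvalues, to units
with distinct indices, where they are. `mul_zero_odd_unit` does the same for the second block. -/
theorem mul_one_odd_unit (p : Fin k₁) (r : Fin k₂) (m n : ℕ) :
    mul F 1 (symUnit F (.inl p) (.inr r) 0 0) (unit F (.inl p) (.inl p) m n) =
      ((n : F) + 1) • unit F (.inl p) (.inr r) m n +
        ((m : F) + 1) • unit F (.inr r) (.inl p) m n := by
  rw [mul_symUnit_unit, mul_unit, mul_unit]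
  simp [coeffLeft, coeffRight, sgn_zero_left, del0, del1, val_one_zmod]

theorem mul_zero_odd_unit (p : Fin k₁) (r : Fin k₂) (m n : ℕ) :
    mul F 0 (symUnit F (.inl p) (.inr r) 0 0) (unit F (.inr r) (.inr r) m n) =
      unit F (.inl p) (.inr r) m n - unit F (.inr r) (.inl p) m n := by
  rw [mul_symUnit_unit, mul_unit, mul_unit]
  simp [coeffLeft, coeffRight, sgn_zero_left, del0, del1, val_one_zmod, one_add_one_eq_zero_zmod,
    sub_eq_add_neg]

theorem odd_symUnit_eq (p : Fin k₁) (r : Fin k₂) :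
    symUnit F (.inl p) (.inr r) 0 0 =
      E F 0 1 (Sum.inl p) (Sum.inr r) 0 0 + E F 1 0 (Sum.inr r) (Sum.inl p) 0 0 := by
  simp [symUnit, unit, sgn_zero_left]

theorem quad_inr_eq (r : Fin k₂) : quad F (.inr r : Fin k₁ ⊕ Fin k₂) =
    E F 1 1 (Sum.inr r) (Sum.inr r) 0 1 - E F 1 1 (Sum.inr r) (Sum.inr r) 1 0 := by
  simp [quad, symUnit, unit, sgn_one_one, del1, sub_eq_add_neg]

theorem apply_comb_of_support (L : Ambient (Mat F k₁ k₂) →ₗ[F] F) (g : UnitIndex k₁ k₂ →₀ F)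
    (a : Fin k₁ ⊕ Fin k₂) (m n : ℕ) (hg : ∀ i, g i ≠ 0 → i.1 = (a, a))
    (hL : ∀ m' n', (m', n') ≠ (m, n) → L (unit F a a m' n') = 0) :
    L (comb F k₁ k₂ g) = g ((a, a), (m, n)) * L (unit F a a m n) := by
  rw [comb, Finsupp.linearCombination_apply, Finsupp.sum, map_sum,
    Finset.sum_eq_single ((a, a), (m, n))]
  · rw [map_smul, smul_eq_mul]
  · intro i hi hne
    have h1 := hg i (Finsupp.mem_support_iff.1 hi)
    obtain ⟨⟨p, q⟩, m', n'⟩ := i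
    simp only [Prod.mk.injEq] at h1
    obtain ⟨rfl, rfl⟩ := h1
    rw [map_smul, hL m' n' (fun h => hne (by rw [h])), smul_zero]
  · intro h
    rw [Finsupp.notMem_support_iff.1 h, zero_smul, map_zero]

variable [CharZero F]

section Ideal

variable {J : Submodule F (Ambient (Mat F k₁ k₂))} (hle : J ≤ starAlg F k₁ k₂)
  (hJ : ∀ n, ∀ u ∈ starAlg F k₁ k₂, ∀ x ∈ J, mul F n u x ∈ J)

-- A nonzero coefficient at distinct indices gives a symmetric unit directly, and an odd generator
-- makes it odd if necessary. At a repeated index, first project to the joint eigenspace; an odd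
-- generator then sends different exponent pairs to different units, so the chosen coefficient
-- survives.
include hle hJ in
theorem exists_odd_symUnit_mem (p₀ : Fin k₁) (r₀ : Fin k₂) (hne : J ≠ ⊥) :
    ∃ (p : Fin k₁) (r : Fin k₂) (m n : ℕ), symUnit F (.inl p) (.inr r) m n ∈ J := by
  classical
  obtain ⟨x, hx, hx0⟩ := (Submodule.ne_bot_iff J).1 hne
  obtain ⟨f, rfl⟩ : x ∈ LinearMap.range (comb F k₁ k₂) := by
    rw [range_comb]; exact starAlg_le_blockAlg (hle hx)
  obtain ⟨⟨⟨a, b⟩, m, n⟩, hj⟩ : ∃ j, f j ≠ 0 := by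
    by_contra! h
    exact hx0 (by rw [show f = 0 from Finsupp.ext h, map_zero])
  by_cases hab : a = b
  · subst hab
    have hg := comb_filter_mem hJ f hx ((a, a), (m, n))
    set g := f.filter fun i => ∀ c, weight F c i = weight F c ((a, a), (m, n)) with hgdef
    have hgj : g ((a, a), (m, n)) ≠ 0 := by
      rw [hgdef, Finsupp.filter_apply_pos _ _ (fun _ => rfl)]; exact hj
    have hsupp : ∀ i, g i ≠ 0 → i.1 = (a, a) := fun i hi =>
      fst_eq_of_weight_eq (F := F) (m := m) (n := n) (by
        by_contra h
        exact hi (Finsupp.filter_apply_neg _ _ h))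
    rcases a with p | r
    · refine ⟨p, r₀, m, n, symUnit_mem_of_coord_ne_zero hle hJ (by simp)
        (hJ 1 _ (symUnit_mem_starAlg (.inl p) (.inr r₀) 0 0) _ hg) ?_⟩
      have := apply_comb_of_support ((coord F ((.inl p, .inr r₀), (m, n))).comp
        (mul F 1 (symUnit F (.inl p) (.inr r₀) 0 0))) g (.inl p) m n hsupp (fun m' n' h => by
          rw [LinearMap.comp_apply, mul_one_odd_unit, map_add, map_smul, map_smul, coord_unit,
            coord_unit, if_neg (by simpa using h), if_neg (by simp)]
          simp)
      rw [LinearMap.comp_apply] at this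
      rw [this, LinearMap.comp_apply, mul_one_odd_unit, map_add, map_smul, map_smul, coord_unit,
        coord_unit, if_pos rfl, if_neg (by simp), smul_zero, add_zero, smul_eq_mul, mul_one]
      exact mul_ne_zero hgj (by exact_mod_cast n.succ_ne_zero)
    · refine ⟨p₀, r, m, n, symUnit_mem_of_coord_ne_zero hle hJ (by simp)
        (hJ 0 _ (symUnit_mem_starAlg (.inl p₀) (.inr r) 0 0) _ hg) ?_⟩
      have := apply_comb_of_support ((coord F ((.inl p₀, .inr r), (m, n))).comp
        (mul F 0 (symUnit F (.inl p₀) (.inr r) 0 0))) g (.inr r) m n hsupp (fun m' n' h => by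
          rw [LinearMap.comp_apply, mul_zero_odd_unit, map_sub, coord_unit,
            coord_unit, if_neg (by simpa using h), if_neg (by simp), sub_zero])
      rw [LinearMap.comp_apply] at this
      rw [this, LinearMap.comp_apply, mul_zero_odd_unit, map_sub, coord_unit,
        coord_unit, if_pos rfl, if_neg (by simp), sub_zero, mul_one]
      exact hgj
  · have hS : symUnit F a b m n ∈ J :=
      symUnit_mem_of_coord_ne_zero hle hJ hab hx (by rw [coord_comb]; exact hj)
    rcases a with p | r <;> rcases b with q | s
    · have h := hJ 1 _ (symUnit_mem_starAlg (.inl q) (.inr r₀) 0 0) _ hS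
      rw [mul_one_odd_inl p q r₀ m n (by simpa using hab)] at h
      have h2 : (n : F) + 1 ≠ 0 := by exact_mod_cast n.succ_ne_zero
      exact ⟨p, r₀, m, n, mem_of_smul_mem h2 h⟩
    · exact ⟨p, s, m, n, hS⟩
    · exact ⟨q, r, n, m, by rw [symUnit_swap]; exact Submodule.smul_mem _ _ hS⟩
    · have h := hJ 0 _ (symUnit_mem_starAlg (.inl p₀) (.inr r) 0 0) _ hS
      rw [mul_zero_odd_inr p₀ r s m n (by simpa using hab)] at h
      exact ⟨p₀, s, m, n, h⟩

include hJ in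
theorem odd_symUnit_zero_mem {p : Fin k₁} {r : Fin k₂} {m n : ℕ}
    (h : symUnit F (.inl p) (.inr r) m n ∈ J) : symUnit F (.inl p) (.inr r) 0 0 ∈ J := by
  have h1 := hJ (m + 1) _ (quad_mem_starAlg (.inl p)) _ h
  rw [lower_inl] at h1
  have hm : (2 * ((m : F) + 1)) ≠ 0 := mul_ne_zero two_ne_zero (by exact_mod_cast m.succ_ne_zero)
  have h2 := hJ (n + 1) _ (quad_mem_starAlg (.inr r)) _ (mem_of_smul_mem hm h1)
  rw [lower_inr] at h2
  have hn : (-((n : F) + 1)) ≠ 0 := neg_ne_zero.2 (by exact_mod_cast n.succ_ne_zero)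
  exact mem_of_smul_mem hn h2

include hJ in
theorem quad_mem_of_odd_mem {p : Fin k₁} {r : Fin k₂}
    (h : symUnit F (.inl p) (.inr r) 0 0 ∈ J) : quad F (.inl p) ∈ J ∧ quad F (.inr r) ∈ J := by
  have h1 := hJ 0 _ (symUnit_mem_starAlg (.inl p) (.inr r) 0 0) _ h
  have h2 : quad F (.inl p) ∈ J := by
    have h3 := h1
    rw [mul_zero_odd, ← one_smul F (symUnit F (.inl p) (.inl p) 0 0)] at h3
    exact symUnit_mem_of_add_mem (a := .inl p) (hJ 1 _ (quad_mem_starAlg _)) (Or.inl rfl)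
      (by simp) (by simp) one_ne_zero h3
  rw [mul_zero_odd_self] at h1
  exact ⟨h2, by simpa using sub_mem h2 h1⟩

-- The symmetric unit is an eigenvector of the first product with `quad a` for a nonzero eigenvalue.
-- Skew-symmetry rewrites that product through products acting on `quad a` from the left and powers
-- of ∂, under which `J` is stable.
include hJ in
theorem symUnit_mem_of_quad_mem (hD : ∀ x ∈ J, D F x ∈ J) {a b c : Fin k₁ ⊕ Fin k₂} (m n : ℕ)
    (hbc : b = a ∨ c = a) (h : quad F a ∈ J) : symUnit F b c m n ∈ J := by
  refine mem_of_smul_mem (eig_total_ne_zero m n hbc) (?_ : _ ∈ J)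
  rw [← mul_one_quad_symUnit]
  obtain ⟨N, hN⟩ := exists_mul_eq_zero (F := F) (symUnit F b c m n) (quad F a)
  rw [mul_skew (starPart_le_parityPart _ (show quad F a ∈ _ from symUnit_mem_starPart _ _ _ _))
    (starPart_le_parityPart _ (symUnit_mem_starPart _ _ _ _)) 1 N hN]
  refine Submodule.smul_mem _ _ (Submodule.sum_mem _ fun l _ => Submodule.smul_mem _ _ ?_)
  have hDl : ∀ l, ∀ x ∈ J, (D F ^ l) x ∈ J := by
    intro l
    induction l with
    | zero => simp
    | succ l ih => intro x hx; rw [pow_succ', Module.End.mul_apply]; exact hD _ (ih x hx)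
  exact hDl l _ (hJ _ _ (symUnit_mem_starAlg _ _ _ _) _ h)

include hle hJ in
theorem eq_bot_or_eq_starAlg (hD : ∀ x ∈ J, D F x ∈ J) (p₀ : Fin k₁) (r₀ : Fin k₂) :
    J = ⊥ ∨ J = starAlg F k₁ k₂ := by
  refine or_iff_not_imp_left.2 fun hne => le_antisymm hle ?_
  obtain ⟨p, r, m, n, h⟩ := exists_odd_symUnit_mem hle hJ p₀ r₀ hne
  obtain ⟨hp, -⟩ := quad_mem_of_odd_mem hJ (odd_symUnit_zero_mem hJ h)
  -- A single index of the first block yields all odd generators containing it, hence every `quad`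
  -- of the second block; one of those leads back to every `quad` of the first.
  have hr : ∀ s, quad F (.inr s : Fin k₁ ⊕ Fin k₂) ∈ J := fun s =>
    (quad_mem_of_odd_mem hJ (symUnit_mem_of_quad_mem hJ hD 0 0 (Or.inl rfl) hp)).2
  have hq : ∀ q, quad F (.inl q : Fin k₁ ⊕ Fin k₂) ∈ J := fun q =>
    (quad_mem_of_odd_mem hJ (symUnit_mem_of_quad_mem hJ hD 0 0 (Or.inr rfl) (hr r₀))).1
  rw [starAlg_eq_span, Submodule.span_le]
  rintro x ⟨a, b, m, n, rfl⟩
  rcases a with q | s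
  · exact symUnit_mem_of_quad_mem hJ hD m n (Or.inl rfl) (hq q)
  · exact symUnit_mem_of_quad_mem hJ hD m n (Or.inl rfl) (hr s)

end Ideal

theorem isSimple_starConformal (p₀ : Fin k₁) (r₀ : Fin k₂) :
    (starConformal F k₁ k₂).IsSimple := by
  rintro I ⟨hD, hmul⟩
  have hinj := (starAlg F k₁ k₂).injective_subtype
  rcases eq_bot_or_eq_starAlg (J := I.map (starAlg F k₁ k₂).subtype)
    (Submodule.map_subtype_le _ _) (by
      rintro n u hu _ ⟨x, hx, rfl⟩
      exact ⟨_, hmul n ⟨u, hu⟩ x hx, rfl⟩) (by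
      rintro _ ⟨x, hx, rfl⟩
      exact ⟨_, hD x hx, rfl⟩) p₀ r₀ with h | h
  · exact Or.inl (Submodule.map_injective_of_injective hinj (by rw [h, Submodule.map_bot]))
  · refine Or.inr (Submodule.map_injective_of_injective hinj ?_)
    rw [h, Submodule.map_subtype_top]

end DoubleAffine

end

/-! ### Assembly of the theorem. -/

theorem theorem4p2 {F : Type*} [Field F] [CharZero F] (k₁ k₂ : ℕ) (h₁ : 0 < k₁) (h₂ : 0 < k₂) :
    DoubleAffine.starAlg F k₁ k₂ ≤ DoubleAffine.blockAlg F k₁ k₂ 0 ∧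
    DoubleAffine.blockAlg F k₁ k₂ 0 ≤
      DoubleAffine.fullSpace (DoubleAffine.matGrading F k₁ k₂) ∧
    -- the weight-3/2 subspace
    DoubleAffine.starAlg F k₁ k₂ ⊓
        DoubleAffine.weightSpace (DoubleAffine.matGrading F k₁ k₂) (3 / 2) =
      Submodule.span F {x | ∃ (p : Fin k₁) (q : Fin k₂),
        x = DoubleAffine.E F 0 1 (Sum.inl p) (Sum.inr q) 0 0 +
          DoubleAffine.E F 1 0 (Sum.inr q) (Sum.inl p) 0 0} ∧
    -- the operations of the big algebra restrict to a conformal superalgebra structure `C`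
    ∃ C : ConformalSuperalgebra F (DoubleAffine.starAlg F k₁ k₂),
      (∀ i : ZMod 2, (C.parity i).map (DoubleAffine.starAlg F k₁ k₂).subtype =
        DoubleAffine.starPart F k₁ k₂ i) ∧
      (∀ x : DoubleAffine.starAlg F k₁ k₂,
        (C.D x : DoubleAffine.Ambient (DoubleAffine.Mat F k₁ k₂)) = DoubleAffine.D F x) ∧
      (∀ (n : ℕ) (x y : DoubleAffine.starAlg F k₁ k₂),
        (C.mul n x y : DoubleAffine.Ambient (DoubleAffine.Mat F k₁ k₂)) =
          DoubleAffine.mul F n x y) ∧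
      C.IsSimple ∧
      (2 < k₁ + k₂ →
        C.IsGeneratedBy {x | (x : DoubleAffine.Ambient (DoubleAffine.Mat F k₁ k₂)) ∈
          DoubleAffine.weightSpace (DoubleAffine.matGrading F k₁ k₂) (3 / 2)}) ∧
      (k₁ + k₂ = 2 →
        C.IsGeneratedBy {x |
          (x : DoubleAffine.Ambient (DoubleAffine.Mat F k₁ k₂)) =
            DoubleAffine.E F 0 1 (Sum.inl ⟨0, h₁⟩) (Sum.inr ⟨0, h₂⟩) 0 0 +
              DoubleAffine.E F 1 0 (Sum.inr ⟨0, h₂⟩) (Sum.inl ⟨0, h₁⟩) 0 0 ∨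
          (x : DoubleAffine.Ambient (DoubleAffine.Mat F k₁ k₂)) =
            DoubleAffine.E F 1 1 (Sum.inr ⟨0, h₂⟩) (Sum.inr ⟨0, h₂⟩) 0 1 -
              DoubleAffine.E F 1 1 (Sum.inr ⟨0, h₂⟩) (Sum.inr ⟨0, h₂⟩) 1 0}) := by
  have hw : DoubleAffine.starAlg F k₁ k₂ ⊓
      DoubleAffine.weightSpace (DoubleAffine.matGrading F k₁ k₂) (3 / 2) =
      Submodule.span F {x | ∃ (p : Fin k₁) (q : Fin k₂),
        x = DoubleAffine.E F 0 1 (Sum.inl p) (Sum.inr q) 0 0 +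
          DoubleAffine.E F 1 0 (Sum.inr q) (Sum.inl p) 0 0} := by
    rw [DoubleAffine.starAlg_inf_weightSpace]
    simp only [DoubleAffine.odd_symUnit_eq]
  have hodd : ∀ (p : Fin k₁) (r : Fin k₂), DoubleAffine.symUnit F (.inl p) (.inr r) 0 0 ∈
      DoubleAffine.starPart F k₁ k₂ 1 := fun p r =>
    DoubleAffine.symUnit_mem_starPart (.inl p) (.inr r) 0 0
  refine ⟨DoubleAffine.starAlg_le_blockAlg, DoubleAffine.blockAlg_le_fullSpace, hw,
    DoubleAffine.starConformal F k₁ k₂, DoubleAffine.map_parity_starConformal, fun _ => rfl,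
    fun _ _ _ => rfl, DoubleAffine.isSimple_starConformal ⟨0, h₁⟩ ⟨0, h₂⟩, fun hk => ?_,
    fun hk => ?_⟩
  · refine DoubleAffine.isGeneratedBy_of_generators h₁ h₂ (fun u hu => ⟨1, ?_⟩) (fun p r => ?_)
      (Or.inl hk)
    · have hu' : (u : DoubleAffine.Ambient (DoubleAffine.Mat F k₁ k₂)) ∈
          DoubleAffine.starAlg F k₁ k₂ ⊓
            DoubleAffine.weightSpace (DoubleAffine.matGrading F k₁ k₂) (3 / 2) := ⟨u.2, hu⟩
      rw [DoubleAffine.starAlg_inf_weightSpace] at hu'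
      refine (Submodule.span_le.2 ?_ : _ ≤ DoubleAffine.starPart F k₁ k₂ 1) hu'
      rintro _ ⟨p, r, rfl⟩
      exact hodd p r
    · have : DoubleAffine.symUnit F (.inl p) (.inr r) 0 0 ∈ DoubleAffine.starAlg F k₁ k₂ ⊓
          DoubleAffine.weightSpace (DoubleAffine.matGrading F k₁ k₂) (3 / 2) := by
        rw [DoubleAffine.starAlg_inf_weightSpace]
        exact Submodule.subset_span ⟨p, r, rfl⟩
      exact this.2
  · obtain rfl : k₁ = 1 := by omega
    obtain rfl : k₂ = 1 := by omega
    refine DoubleAffine.isGeneratedBy_of_generators h₁ h₂ ?_ (fun p r => ?_)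
      (Or.inr ⟨.inr ⟨0, h₂⟩, Or.inr (DoubleAffine.quad_inr_eq _)⟩)
    · rintro u (hu | hu)
      · refine ⟨1, ?_⟩
        rw [← DoubleAffine.odd_symUnit_eq] at hu
        change (u : DoubleAffine.Ambient (DoubleAffine.Mat F 1 1)) ∈ DoubleAffine.starPart F 1 1 1
        rw [hu]
        exact hodd _ _
      · refine ⟨0, ?_⟩
        rw [← DoubleAffine.quad_inr_eq] at hu
        change (u : DoubleAffine.Ambient (DoubleAffine.Mat F 1 1)) ∈ DoubleAffine.starPart F 1 1 0
        rw [hu]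
        exact DoubleAffine.symUnit_mem_starPart (F := F) (.inr ⟨0, h₂⟩) (.inr ⟨0, h₂⟩) 0 1
    · obtain rfl : p = ⟨0, h₁⟩ := Subsingleton.elim _ _
      obtain rfl : r = ⟨0, h₂⟩ := Subsingleton.elim _ _
      exact Or.inl (DoubleAffine.odd_symUnit_eq _ _)
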